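/- Let $G$ be a simply connected (real, smooth) Lie group of dimension $n$ whose Lie algebra $\mathfrak g$ is stratified: $\mathfrak g=\mathfrak g_1\oplus\cdots\oplus\mathfrak g_s$ with $\mathfrak g_{i}=[\mathfrak g_{i-1},\mathfrak g_1]$ for $2\le i\le s$ and $[\mathfrak g_s,\mathfrak g_1]=\{0\}$; put $\mathfrak g_i=\{0\}$ for $i>s$ and $r=\dim\mathfrak g_1$. Let $\mathrm{Prol}(\mathfrak g)=\bigoplus_{k\le s}\mathfrak g_k$ be the Tanaka prolongation of $\mathfrak g$, i.e. the graded Lie algebra whose part of positive degree is $\mathfrak g$ and in which, for every $k\le 0$, the map $\varphi\mapsto[\varphi,\cdot\,]$ is a bijection of $\mathfrak g_k$ onto the space of linear maps $D:\mathfrak g\to\mathrm{Prol}(\mathfrak g)$ with $D(\mathfrak g_i)\subset\mathfrak g_{i+k}$ for all $i\ge1$ and $D[X,Y]=[DX,Y]+[X,DY]$ for all $X,Y\in\mathfrak g$. Let $\{X_j\}_{j\le n}$ be a basis of $\mathrm{Prol}(\mathfrak g)$ adapted to the grading, where $j$ ranges over all integers $\le n$ or over $m\le j\le n$ for some integer $m$: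 each $X_j$ lies in $\mathfrak g_{d(j)}$ for some integer $d(j)$, $i<j$ implies $d(i)\le d(j)$, and $X_1,\dots,X_n$ is a basis of $\mathfrak g$. Define real numbers $c_{ij}^k$ and, for $\alpha\in\mathbb N^n$, $c_{j\alpha}^k$ by the finite sums $$[X_i,X_j]=\sum_{k\le n}c_{ij}^kX_k,\qquad [\cdots[X_j,\underbrace{X_1],\dots,X_1]}_{\alpha_1},\dots,\underbrace{X_n],\dots,X_n]}_{\alpha_n}=\sum_{k\le n}c_{j\alpha}^kX_k .$$ For $v\in\mathbb R^n$, with the convention $v_k=0$ for $k\le0$, let $$P_j^v(x)=\sum_{\alpha\in\mathbb N^n}\frac{(-1)^{|\alpha|}}{\alpha!}\Big(\sum_{k\le n}c_{j\alpha}^kv_k\Big)x^\alpha,\qquad x\in\mathbb R^n,\ j\le n .$$ Use exponential coordinates of the second type $\Phi:\mathbb R^n\to G$, $\Phi(x)=\exp(x_nX_n)\cdots\exp(x_1X_1)$, and regard the left invariant vector fields $X_1,\dots,X_n$ of $G$ as vector fields on $\mathbb R^n$ by pulling them back along $\Phi$ (the differential of $\Phi$ is invertible at every point). Then, for every $v\in\mathbb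 R^n$, the $P_j^v$ are polynomials (only finitely many coefficients are nonzero), and $$X_iP_j^v=\sum_{k\le n}c_{ij}^kP_k^v\quad\text{on }\mathbb R^n,\qquad i=1,\dots,n,\quad j\le n. \tag{1}$$ Moreover $P_j^v(0)=v_j$ for all $j\le n$, and $\{P_j^v\}_{j\le n}$ is the only family of smooth functions on $\mathbb R^n$ (in particular, of polynomials) that satisfies (1) for $i=1,\dots,r$ and all $j\le n$ and takes the values $v_j$ at $x=0$, $j\le n$. -/

import Mathlib

open scoped Manifold ContDiff

/-- A smooth real Lie group has the regularity that Mathlib asks for in order to put the Lie bracket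
on `GroupLieAlgebra`. -/
instance instLieGroupMinSmoothnessOfSmooth {H : Type*} [TopologicalSpace H] {E : Type*}
    [NormedAddCommGroup E] [NormedSpace ℝ E] {I : ModelWithCorners ℝ E H} {G : Type*}
    [TopologicalSpace G] [ChartedSpace H G] [Group G] [LieGroup I ∞ G] :
    LieGroup I (minSmoothness ℝ 3) G := by
  rw [minSmoothness_of_isRCLikeNormedField]
  infer_instance

/-! ### Stratifications and the Tanaka prolongation -/

/-- `𝔤 = 𝔤₁ ⊕ ⋯ ⊕ 𝔤ₛ` with `𝔤_{i+1} = [𝔤_i, 𝔤₁]` for `i ≥ 1` and `𝔤_i = 0` for `i > s`.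
The strata are indexed by `ℕ`, with `V 0 = 0`. -/
structure IsStratification {𝔤 : Type*} [LieRing 𝔤] [LieAlgebra ℝ 𝔤]
    (V : ℕ → Submodule ℝ 𝔤) : Prop where
  isInternal : DirectSum.IsInternal V
  zero_eq_bot : V 0 = ⊥
  succ_eq_span : ∀ i : ℕ, 1 ≤ i →
    V (i + 1) = Submodule.span ℝ {z : 𝔤 | ∃ x ∈ V i, ∃ y ∈ V 1, z = ⁅x, y⁆}
  eq_bot_of_gt : ∃ s : ℕ, ∀ i : ℕ, s < i → V i = ⊥

/-- The graded Lie algebra `𝔭 = ⨁_{k ∈ ℤ} 𝔭_k`, together with `ι : 𝔤 → 𝔭`, is the Tanaka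
prolongation of the stratified Lie algebra `𝔤 = ⨁_{k ≥ 1} 𝔤_k`: its part of positive degree is `𝔤`
(so `𝔭_k = 0` for `k` larger than the step), and for each `k ≤ 0` the assignment
`φ ↦ [φ, ·]` is a bijection of `𝔭_k` onto the space of all linear maps `D : 𝔤 → 𝔭` with
`D(𝔤_i) ⊆ 𝔭_{i+k}` for all `i ≥ 1` and `D[X, Y] = [D X, Y] + [X, D Y]` for all `X, Y ∈ 𝔤`.
As `i + k < i`, this is the inductive construction of the spaces `𝔭_0, 𝔭_{-1}, 𝔭_{-2}, …` and of the
brackets `[φ, X] = φ(X)`. The brackets `[φ, ψ]` with both factors of degree `≤ 0` are then forced by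
the Jacobi identity `[[φ, ψ], X] = [[φ, X], ψ] + [φ, [ψ, X]]`. So these conditions
determine `(𝔭, ι)` up to a unique isomorphism. -/
structure IsTanakaProlongation {𝔤 : Type*} [LieRing 𝔤] [LieAlgebra ℝ 𝔤]
    (V : ℕ → Submodule ℝ 𝔤) {𝔭 : Type*} [LieRing 𝔭] [LieAlgebra ℝ 𝔭]
    (W : ℤ → Submodule ℝ 𝔭) (ι : 𝔤 →ₗ⁅ℝ⁆ 𝔭) : Prop where
  isInternal : DirectSum.IsInternal W
  lie_mem : ∀ (i j : ℤ) (x y : 𝔭), x ∈ W i → y ∈ W j → ⁅x, y⁆ ∈ W (i + j)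
  injective : Function.Injective ι
  pos_part : ∀ k : ℕ, 1 ≤ k → W (k : ℤ) = (V k).map (ι : 𝔤 →ₗ[ℝ] 𝔭)
  existsUnique_derivation : ∀ k : ℤ, k ≤ 0 → ∀ D : 𝔤 →ₗ[ℝ] 𝔭,
    (∀ i : ℕ, 1 ≤ i → ∀ x ∈ V i, D x ∈ W ((i : ℤ) + k)) →
    (∀ x y : 𝔤, D ⁅x, y⁆ = ⁅D x, ι y⁆ + ⁅ι x, D y⁆) →
    ∃! φ : 𝔭, φ ∈ W k ∧ ∀ x : 𝔤, ⁅φ, ι x⁆ = D x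

/-! ### Structure constants and extremal polynomials

The bases of the prolongation are indexed by a set `J` of integers with `{1, …, n} ⊆ J`, and all
elements of `J` are `≤ n`. -/

/-- The index `i ∈ {1, …, n}`, with `i - 1 : Fin n` as its zero-based version. -/
def posIndex {n : ℕ} {J : Set ℤ} (hJ : Set.Icc 1 (n : ℤ) ⊆ J) (i : Fin n) : J :=
  ⟨(i : ℤ) + 1, hJ ⟨by omega, by omega⟩⟩

/-- `v = (v₁, …, vₙ) ∈ ℝⁿ`, extended by `v_k = 0` for `k ≤ 0`. -/
def extendZero {n : ℕ} (v : EuclideanSpace ℝ (Fin n)) (k : ℤ) : ℝ :=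
  if h : 1 ≤ k ∧ k ≤ (n : ℤ) then v ⟨(k - 1).toNat, by omega⟩ else 0

section Polynomials

variable {n : ℕ} {J : Set ℤ} {𝔭 : Type*} [LieRing 𝔭] [LieAlgebra ℝ 𝔭]

/-- The structure constants: `[X_i, X_j] = ∑ₖ c_{ij}^k X_k`, a finite sum. -/
noncomputable def structureConst (b : Module.Basis J ℝ 𝔭) (i j : J) : J →₀ ℝ :=
  b.repr ⁅b i, b j⁆

/-- The iterated commutator `[Y, X_α] = [⋯[Y, X₁], …, X₁], X₂], …, X₂], …, Xₙ], …, Xₙ]`, where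
`X_i` occurs `α_i` times. -/
def iteratedLie (X : Fin n → 𝔭) (α : Fin n →₀ ℕ) (Y : 𝔭) : 𝔭 :=
  (List.finRange n).foldl (fun A i => (fun Z => ⁅Z, X i⁆)^[α i] A) Y

/-- The generalized structure constants: `[X_j, X_α] = ∑ₖ c_{jα}^k X_k`, a finite sum. -/
noncomputable def genStructureConst (hJ : Set.Icc 1 (n : ℤ) ⊆ J) (b : Module.Basis J ℝ 𝔭)
    (j : J) (α : Fin n →₀ ℕ) : J →₀ ℝ :=
  b.repr (iteratedLie (fun i => b (posIndex hJ i)) α (b j))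

/-- `φ_{jα}(v) = (-1)^{|α|} / α! * ∑ₖ c_{jα}^k v_k`, where `v_k = 0` for `k ≤ 0`. -/
noncomputable def extremalCoeff (hJ : Set.Icc 1 (n : ℤ) ⊆ J) (b : Module.Basis J ℝ 𝔭)
    (v : EuclideanSpace ℝ (Fin n)) (j : J) (α : Fin n →₀ ℕ) : ℝ :=
  (-1) ^ (∑ i, α i) / (∏ i, ((α i).factorial : ℝ)) *
    (genStructureConst hJ b j α).sum fun k c => c * extendZero v k

/-- The extremal polynomial `P_j^v(x) = ∑_α φ_{jα}(v) x^α`. -/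
noncomputable def extremalPolynomial (hJ : Set.Icc 1 (n : ℤ) ⊆ J) (b : Module.Basis J ℝ 𝔭)
    (v : EuclideanSpace ℝ (Fin n)) (j : J) (x : EuclideanSpace ℝ (Fin n)) : ℝ :=
  ∑ᶠ α : Fin n →₀ ℕ, extremalCoeff hJ b v j α * ∏ i, x i ^ α i

end Polynomials

/-! ### Exponential coordinates of the second type -/

section Coordinates

variable {n : ℕ} {G : Type*} [TopologicalSpace G] [ChartedSpace (EuclideanSpace ℝ (Fin n)) G]
  [Group G]

open Classical in
/-- The exponential map of a Lie group: `exp X = γ(1)`, where `γ : ℝ → G` is the integral curve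
through the identity of the left invariant vector field given by `X`. -/
noncomputable def lieExp (X : GroupLieAlgebra (𝓡 n) G) : G :=
  if h : ∃ γ : ℝ → G, γ 0 = 1 ∧ IsMIntegralCurve γ (mulInvariantVectorField (I := 𝓡 n) X) then
    h.choose 1
  else 1

/-- Exponential coordinates of the second type: `x ↦ exp(xₙ Xₙ) ⋯ exp(x₁ X₁)`. -/
noncomputable def secondKindExp (X : Fin n → GroupLieAlgebra (𝓡 n) G)
    (x : EuclideanSpace ℝ (Fin n)) : G :=
  ((List.finRange n).reverse.map fun i => lieExp (x i • X i)).prod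

/-- The left invariant vector field `Y` on `G`, written in exponential coordinates of the second
type: at `x ∈ ℝⁿ`, it is the vector that the differential of `secondKindExp X` at `x` sends to the
value of `Y` at the point `secondKindExp X x`. -/
noncomputable def coordField (X : Fin n → GroupLieAlgebra (𝓡 n) G)
    (Y : GroupLieAlgebra (𝓡 n) G) (x : EuclideanSpace ℝ (Fin n)) : EuclideanSpace ℝ (Fin n) :=
  VectorField.mpullback (𝓡 n) (𝓡 n) (secondKindExp X) (mulInvariantVectorField Y) x

end Coordinates

/-! ### One-parameter subgroups and the exponential map of a Lie group. -/

section LieGroupExp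

open Set Filter Topology

variable {n : ℕ} {G : Type*} [TopologicalSpace G] [ChartedSpace (EuclideanSpace ℝ (Fin n)) G]
  [Group G] [LieGroup (𝓡 n) ∞ G]

/-! Let `λ` be the linear functional on the prolongation with `λ(X_k) = v_k` (`valueFunctional`).
The signs `(-1)^|α|` turn right brackets into left ones, so that `P_j^v(x) = λ(exp(x_n ad X_n) ⋯
exp(x_1 ad X_1) X_j)`, formally the coefficient `λ(Ad(Φ(x)) X_j)`
(`extremalPolynomial_eq_expAction`). Bracketing with an element of `𝔤` raises degrees, and degrees
are bounded above; hence all these exponentials are finite sums and `P_j^v` is a polynomial.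
Differentiating along the left invariant field `X_i` inserts `ad X_i` on the right, giving
`λ(Ad(Φ(x)) [X_i, X_j])`, which is (1).

The group need not act on the prolongation, so the link is the Maurer-Cartan form `ω` in the
coordinates `Φ` (`mcForm`). On the group side, `dΦ_x(u)` is the left translate of `ω_x(u)`
(`mfderiv_expProd`); this rests on `Ad(exp tX) = exp(t ad X)`, hence on the derivative of `Ad` being
the bracket (`hasDerivAt_lieAd_expCurve_zero`). On the algebraic side, the product of exponentials
`A(x)` satisfies `dA(u) = A(x) ad(ω_x(u))` (`hasFDerivAt_expAction`). As `ω_x` is unipotent for the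
degree filtration, it is invertible (`mcForm_isInvertible`), and the field `Y` in coordinates is
`ω⁻¹Y` (`coordField_eq_inverse`).

Uniqueness is by descending induction on the degree of `X_j`. The brackets `[X_i, X_j]` have higher
degree, so the difference of two solutions is annihilated by `X_1, …, X_r`. By the Maurer-Cartan
equation the directions annihilating a function form a Lie subalgebra; here it contains `𝔤_1`, hence
is `𝔤`, and the difference is constant (`eq_of_fderiv_inverse_eq_zero`). -/

lemma mdifferentiableAt_mul_left_lieGroup (g h : G) :
    MDifferentiableAt (𝓡 n) (𝓡 n) (g * ·) h :=
  (contMDiff_mul_left (I := 𝓡 n) (n := ∞)).contMDiffAt.mdifferentiableAt (by simp)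

lemma mdifferentiableAt_mul_right_lieGroup (g h : G) :
    MDifferentiableAt (𝓡 n) (𝓡 n) (· * g) h :=
  (contMDiff_mul_right (I := 𝓡 n) (n := ∞)).contMDiffAt.mdifferentiableAt (by simp)

/-- Left translations preserve left invariant vector fields. -/
lemma mfderiv_mul_left_mulInvariantVectorField (g h : G) (X : GroupLieAlgebra (𝓡 n) G) :
    mfderiv (𝓡 n) (𝓡 n) (g * ·) h (mulInvariantVectorField X h) =
      mulInvariantVectorField X (g * h) := by
  have D : (fun x ↦ (g * h) * x) = (fun b ↦ g * b) ∘ (fun x ↦ h * x) := by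
    ext x; simp [mul_assoc]
  -- The chain rule gives the derivative at `h * 1`; a free base point `h'` allows replacing it by
  -- `h`, although the tangent space depends on the point.
  have key : ∀ h' : G, h * 1 = h' → mfderiv (𝓡 n) (𝓡 n) (fun x ↦ (g * h) * x) (1 : G) =
      (mfderiv (𝓡 n) (𝓡 n) (g * ·) h').comp (mfderiv (𝓡 n) (𝓡 n) (h * ·) (1 : G)) := by
    rintro _ rfl
    rw [D]
    exact mfderiv_comp (I' := 𝓡 n) _ (mdifferentiableAt_mul_left_lieGroup _ _)
      (mdifferentiableAt_mul_left_lieGroup _ _)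
  exact (DFunLike.congr_fun (key h (mul_one h)) X).symm

lemma contMDiff_one_mulInvariantVectorField (X : GroupLieAlgebra (𝓡 n) G) :
    ContMDiff (𝓡 n) (𝓡 n).tangent 1
      (fun g : G ↦ (⟨g, mulInvariantVectorField X g⟩ : TangentBundle (𝓡 n) G)) :=
  (contMDiff_mulInvariantVectorField X).of_le (by
    rw [minSmoothness_of_isRCLikeNormedField]; norm_num)

lemma IsMIntegralCurveOn.mul_left {γ : ℝ → G} {X : GroupLieAlgebra (𝓡 n) G} {s : Set ℝ}
    (h : IsMIntegralCurveOn γ (mulInvariantVectorField (I := 𝓡 n) X) s) (g : G) :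
    IsMIntegralCurveOn (fun t => g * γ t) (mulInvariantVectorField (I := 𝓡 n) X) s := by
  intro t ht
  have h1 := (mdifferentiableAt_mul_left_lieGroup (n := n) g (γ t)).hasMFDerivAt
  refine (h1.comp_hasMFDerivWithinAt t (h t ht)).congr_mfderiv ?_
  ext
  rw [← mfderiv_mul_left_mulInvariantVectorField]
  change mfderiv (𝓡 n) (𝓡 n) (g * ·) (γ t) ((1:ℝ) • mulInvariantVectorField X (γ t)) =
    (1:ℝ) • mfderiv (𝓡 n) (𝓡 n) (g * ·) (γ t) (mulInvariantVectorField X (γ t))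
  rw [map_smul]

lemma IsMIntegralCurve.mul_left {γ : ℝ → G} {X : GroupLieAlgebra (𝓡 n) G}
    (h : IsMIntegralCurve γ (mulInvariantVectorField (I := 𝓡 n) X)) (g : G) :
    IsMIntegralCurve (fun t => g * γ t) (mulInvariantVectorField (I := 𝓡 n) X) := by
  rw [isMIntegralCurve_iff_isMIntegralCurveOn] at *
  exact IsMIntegralCurveOn.mul_left h g

variable [T2Space G]

/-- Left translates of one local integral curve through the identity give integral curves through
every point with the same time of existence, so the field is complete. -/
lemma exists_isMIntegralCurve_mulInvariantVectorField (X : GroupLieAlgebra (𝓡 n) G) :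
    ∃ γ : ℝ → G, γ 0 = 1 ∧ IsMIntegralCurve γ (mulInvariantVectorField (I := 𝓡 n) X) := by
  have hM : IsManifold (𝓡 n) 1 G := IsManifold.of_le (n := ∞) (by simp)
  obtain ⟨γ, h0, hγ⟩ := exists_isMIntegralCurveAt_of_contMDiffAt_boundaryless (t₀ := 0)
    (contMDiff_one_mulInvariantVectorField X).contMDiffAt (x₀ := (1 : G))
  obtain ⟨ε, hε, h⟩ := isMIntegralCurveAt_iff'.1 hγ
  refine exists_isMIntegralCurve_of_isMIntegralCurveOn
    (contMDiff_one_mulInvariantVectorField X) hε (fun g => ⟨fun t => g * γ t, by simp [h0], ?_⟩) 1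
  rw [Real.ball_eq_Ioo, zero_sub, zero_add] at h
  exact h.mul_left g

lemma eq_of_isMIntegralCurve_mulInvariantVectorField {X : GroupLieAlgebra (𝓡 n) G}
    {γ γ' : ℝ → G} (h : IsMIntegralCurve γ (mulInvariantVectorField (I := 𝓡 n) X))
    (h' : IsMIntegralCurve γ' (mulInvariantVectorField (I := 𝓡 n) X)) (h0 : γ 0 = γ' 0) :
    γ = γ' := by
  have hM : IsManifold (𝓡 n) 1 G := IsManifold.of_le (n := ∞) (by simp)
  exact isMIntegralCurve_Ioo_eq_of_contMDiff_boundaryless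
    (contMDiff_one_mulInvariantVectorField X) h h' h0

/-- Uniqueness of integral curves makes the choice in `lieExp` irrelevant. -/
lemma lieExp_eq {X : GroupLieAlgebra (𝓡 n) G} {γ : ℝ → G} (h0 : γ 0 = 1)
    (h : IsMIntegralCurve γ (mulInvariantVectorField (I := 𝓡 n) X)) : lieExp X = γ 1 := by
  have hex : ∃ γ : ℝ → G, γ 0 = 1 ∧ IsMIntegralCurve γ (mulInvariantVectorField (I := 𝓡 n) X) :=
    ⟨γ, h0, h⟩
  rw [lieExp, dif_pos hex, eq_of_isMIntegralCurve_mulInvariantVectorField hex.choose_spec.2 h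
    (hex.choose_spec.1.trans h0.symm)]

lemma lieExp_smul_eq {X : GroupLieAlgebra (𝓡 n) G} {γ : ℝ → G} (h0 : γ 0 = 1)
    (h : IsMIntegralCurve γ (mulInvariantVectorField (I := 𝓡 n) X)) (t : ℝ) :
    lieExp (t • X) = γ t := by
  have h1 := h.comp_mul t
  rw [← mulInvariantVectorField_smul] at h1
  rw [lieExp_eq (by simp [h0]) h1]
  simp

lemma isMIntegralCurve_lieExp (X : GroupLieAlgebra (𝓡 n) G) :
    IsMIntegralCurve (fun t : ℝ => lieExp (t • X)) (mulInvariantVectorField (I := 𝓡 n) X) := by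
  obtain ⟨γ, h0, h⟩ := exists_isMIntegralCurve_mulInvariantVectorField X
  have : (fun t : ℝ => lieExp (t • X)) = γ := funext (lieExp_smul_eq h0 h)
  rwa [this]

lemma lieExp_zero : lieExp (0 : GroupLieAlgebra (𝓡 n) G) = 1 := by
  obtain ⟨γ, h0, h⟩ := exists_isMIntegralCurve_mulInvariantVectorField (0 : GroupLieAlgebra (𝓡 n) G)
  rw [← zero_smul ℝ (0 : GroupLieAlgebra (𝓡 n) G), lieExp_smul_eq h0 h, h0]

/-- As functions of `t`, both sides are integral curves of one left invariant field with the same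
value at `t = 0`. -/
lemma lieExp_add_smul (X : GroupLieAlgebra (𝓡 n) G) (s t : ℝ) :
    lieExp ((s + t) • X) = lieExp (s • X) * lieExp (t • X) := by
  have h := isMIntegralCurve_lieExp X
  have h1 := h.comp_add s
  have h2 := h.mul_left (lieExp (s • X))
  have := congrFun (eq_of_isMIntegralCurve_mulInvariantVectorField h1 h2
    (by simp [lieExp_zero])) t
  simpa [add_comm] using this

lemma lieExp_neg_smul (X : GroupLieAlgebra (𝓡 n) G) (t : ℝ) :
    lieExp ((-t) • X) = (lieExp (t • X))⁻¹ := by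
  rw [eq_inv_iff_mul_eq_one, ← lieExp_add_smul]
  simp [lieExp_zero]

end LieGroupExp

/-! ### Second derivatives of multiplication and conjugation at the unit. -/

section CommutatorCalculus

open Set Filter Topology

variable {E : Type*} [NormedAddCommGroup E] [NormedSpace ℝ E]

/-- The derivative of `z ↦ D₂F(z, e) w`. -/
lemma hasFDerivAt_fderiv_snd {F : E × E → E} {e : E} (hF : ContDiffAt ℝ 2 F (e, e)) (w : E) :
    HasFDerivAt (fun z : E => fderiv ℝ F (z, e) (0, w))
      (((fderiv ℝ (fderiv ℝ F) (e, e)).flip (0, w)).comp (ContinuousLinearMap.inl ℝ E E)) e := by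
  have h1 : HasFDerivAt (fderiv ℝ F) (fderiv ℝ (fderiv ℝ F) (e, e)) (e, e) :=
    ((hF.fderiv_right (m := 1) (by norm_num)).differentiableAt (by simp)).hasFDerivAt
  have h2 : HasFDerivAt (fun z : E => (z, e)) (ContinuousLinearMap.inl ℝ E E) e :=
    hasFDerivAt_prodMk_left e e
  have h3 := (HasFDerivAt.comp (f := fun z : E => (z, e)) e h1 h2).clm_apply (hasFDerivAt_const ((0 : E), w) e)
  refine h3.congr_fderiv ?_
  ext u
  simp

/-- If `M` is a group law near its unit `e` and `K (z, y) = z y z⁻¹`, then the mixed second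
derivative of `K` at `(e, e)` is the antisymmetrization of that of `M`. -/
lemma fderiv_fderiv_conj {M K : E × E → E} {e : E} (hM : ContDiffAt ℝ 2 M (e, e))
    (hK : ContDiffAt ℝ 2 K (e, e)) (hMl : ∀ᶠ z in 𝓝 e, M (z, e) = z)
    (hKl : ∀ᶠ y in 𝓝 e, K (e, y) = y) (hKr : ∀ᶠ z in 𝓝 e, K (z, e) = e)
    (hMK : ∀ᶠ p in 𝓝 (e, e), M p = M (K p, p.1)) (u w : E) :
    fderiv ℝ (fderiv ℝ K) (e, e) (u, 0) (0, w) =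
      fderiv ℝ (fderiv ℝ M) (e, e) (u, 0) (0, w) - fderiv ℝ (fderiv ℝ M) (e, e) (w, 0) (0, u) := by
  have hKe : K (e, e) = e := hKr.self_of_nhds
  have hMd : ∀ᶠ p in 𝓝 (e, e), DifferentiableAt ℝ M p :=
    (hM.eventually (by simp)).mono fun p hp => hp.differentiableAt (by simp)
  have hKd : ∀ᶠ p in 𝓝 (e, e), DifferentiableAt ℝ K p :=
    (hK.eventually (by simp)).mono fun p hp => hp.differentiableAt (by simp)
  have hi : Tendsto (fun z : E => (z, e)) (𝓝 e) (𝓝 (e, e)) :=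
    (Continuous.prodMk_left e).tendsto e
  have hj : Tendsto (fun z : E => (e, z)) (𝓝 e) (𝓝 (e, e)) :=
    (Continuous.prodMk_right e).tendsto e
  -- This is the derivative in `y` at `e` of `M (z, y) = M (K (z, y), z)`, that is, of `zy =
  -- (zyz⁻¹)z`. Differentiating it again in `z` at `e` gives the claim, up to the symmetry of the
  -- second derivative of `M`.
  have key : (fun z : E => fderiv ℝ M (z, e) (0, w)) =ᶠ[𝓝 e]
      fun z : E => fderiv ℝ M (e, z) (fderiv ℝ K (z, e) (0, w), 0) := by
    filter_upwards [hi.eventually hMK.eventually_nhds, hi.eventually hKd, hj.eventually hMd, hKr]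
      with z h1 h2 h3 h4
    have e1 : fderiv ℝ M (z, e) = fderiv ℝ (fun p : E × E => M (K p, p.1)) (z, e) :=
      Filter.EventuallyEq.fderiv_eq h1
    have h5 : HasFDerivAt (fun p : E × E => (K p, p.1))
        ((fderiv ℝ K (z, e)).prod (ContinuousLinearMap.fst ℝ E E)) (z, e) :=
      h2.hasFDerivAt.prodMk hasFDerivAt_fst
    have h6 : HasFDerivAt M (fderiv ℝ M (e, z)) (K (z, e), z) := by
      rw [h4]; exact h3.hasFDerivAt
    have h7 := (h6.comp (z, e) h5).fderiv
    rw [e1]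
    change fderiv ℝ (M ∘ fun p : E × E => (K p, p.1)) (z, e) (0, w) = _
    rw [h7]
    simp
  have d1 := hasFDerivAt_fderiv_snd hM w
  have d2 := hasFDerivAt_fderiv_snd hK w
  have d3 : HasFDerivAt (fderiv ℝ M) (fderiv ℝ (fderiv ℝ M) (e, e)) (e, e) :=
    ((hM.fderiv_right (m := 1) (by norm_num)).differentiableAt (by simp)).hasFDerivAt
  have d4 : HasFDerivAt (fun z : E => (e, z)) (ContinuousLinearMap.inr ℝ E E) e :=
    hasFDerivAt_prodMk_right e e
  have d5 := (d3.comp e d4).clm_apply (d2.prodMk (hasFDerivAt_const (0 : E) e))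
  have d6 := d1.unique (d5.congr_of_eventuallyEq key)
  have hD2K : fderiv ℝ K (e, e) (0, w) = w := by
    have h1 : HasFDerivAt (fun y : E => K (e, y))
        ((fderiv ℝ K (e, e)).comp (ContinuousLinearMap.inr ℝ E E)) e :=
      (hKd.self_of_nhds.hasFDerivAt).comp e d4
    have h2 : HasFDerivAt (fun y : E => K (e, y)) (ContinuousLinearMap.id ℝ E) e :=
      (hasFDerivAt_id e).congr_of_eventuallyEq hKl
    simpa using DFunLike.congr_fun (h1.unique h2) w
  have hD1M : ∀ a : E, fderiv ℝ M (e, e) (a, 0) = a := by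
    intro a
    have h1 : HasFDerivAt (fun y : E => M (y, e))
        ((fderiv ℝ M (e, e)).comp (ContinuousLinearMap.inl ℝ E E)) e :=
      HasFDerivAt.comp (f := fun z : E => (z, e)) e hMd.self_of_nhds.hasFDerivAt
        (hasFDerivAt_prodMk_left e e)
    have h2 : HasFDerivAt (fun y : E => M (y, e)) (ContinuousLinearMap.id ℝ E) e :=
      (hasFDerivAt_id e).congr_of_eventuallyEq hMl
    simpa using DFunLike.congr_fun (h1.unique h2) a
  have hsymm : IsSymmSndFDerivAt ℝ M (e, e) := hM.isSymmSndFDerivAt (by simp)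
  have d7 := DFunLike.congr_fun d6 u
  simp [hD2K, hD1M] at d7
  rw [d7, hsymm.eq (w, 0) (0, u)]
  abel

end CommutatorCalculus

/-! ### The group operations in the chart at the identity. -/

section ChartAtOne

open Set Filter Topology

lemma two_le_infty : (2 : WithTop ℕ∞) ≤ ∞ :=
  WithTop.coe_le_coe.2 (le_top : (2 : ℕ∞) ≤ ⊤)

variable {n : ℕ} {G : Type*} [TopologicalSpace G] [ChartedSpace (EuclideanSpace ℝ (Fin n)) G]
  [Group G]

variable (n G) in
/-- The multiplication, read in the preferred chart at the identity. -/
noncomputable def chartMul (p : EuclideanSpace ℝ (Fin n) × EuclideanSpace ℝ (Fin n)) :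
    EuclideanSpace ℝ (Fin n) :=
  extChartAt (𝓡 n) (1 : G) ((extChartAt (𝓡 n) (1 : G)).symm p.1 *
    (extChartAt (𝓡 n) (1 : G)).symm p.2)

variable (n G) in
/-- The conjugation `(g, h) ↦ g h g⁻¹`, read in the preferred chart at the identity. -/
noncomputable def chartConj (p : EuclideanSpace ℝ (Fin n) × EuclideanSpace ℝ (Fin n)) :
    EuclideanSpace ℝ (Fin n) :=
  extChartAt (𝓡 n) (1 : G) ((extChartAt (𝓡 n) (1 : G)).symm p.1 *
    (extChartAt (𝓡 n) (1 : G)).symm p.2 * ((extChartAt (𝓡 n) (1 : G)).symm p.1)⁻¹)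

variable (n G) in
/-- The coordinates of the identity. -/
noncomputable def chartOne : EuclideanSpace ℝ (Fin n) := extChartAt (𝓡 n) (1 : G) 1

lemma extChartAt_symm_chartOne :
    (extChartAt (𝓡 n) (1 : G)).symm (chartOne n G) = 1 := by simp [chartOne]

lemma chartOne_eq : extChartAt (𝓡 n) (1 : G) 1 = chartOne n G := rfl

lemma chartOne_mem_target : chartOne n G ∈ (extChartAt (𝓡 n) (1 : G)).target :=
  mem_extChartAt_target (1 : G)

lemma eventually_mem_target : ∀ᶠ z in 𝓝 (chartOne n G), z ∈ (extChartAt (𝓡 n) (1 : G)).target :=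
  extChartAt_target_mem_nhds (1 : G)

variable [LieGroup (𝓡 n) ∞ G]

lemma contMDiffAt_extChartAt_symm_one {z : EuclideanSpace ℝ (Fin n)}
    (hz : z ∈ (extChartAt (𝓡 n) (1 : G)).target) :
    ContMDiffAt 𝓘(ℝ, EuclideanSpace ℝ (Fin n)) (𝓡 n) ∞ (extChartAt (𝓡 n) (1 : G)).symm z := by
  have : IsManifold (𝓡 n) ∞ G := inferInstance
  exact (contMDiffOn_extChartAt_symm (1 : G)).contMDiffAt
    ((isOpen_extChartAt_target (1 : G)).mem_nhds hz)

lemma contDiffAt_chartMul {z : EuclideanSpace ℝ (Fin n)}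
    (hz : z ∈ (extChartAt (𝓡 n) (1 : G)).target) :
    ContDiffAt ℝ ∞ (chartMul n G) (z, chartOne n G) := by
  rw [← contMDiffAt_iff_contDiffAt]
  have h1 := (contMDiffAt_extChartAt_symm_one hz).comp (z, chartOne n G)
    (contDiff_fst (𝕜 := ℝ) (n := ∞) (E := EuclideanSpace ℝ (Fin n))
      (F := EuclideanSpace ℝ (Fin n))).contMDiff.contMDiffAt
  have h2 := (contMDiffAt_extChartAt_symm_one (chartOne_mem_target (G := G))).comp
    (z, chartOne n G) (contDiff_snd (𝕜 := ℝ) (n := ∞) (E := EuclideanSpace ℝ (Fin n))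
      (F := EuclideanSpace ℝ (Fin n))).contMDiff.contMDiffAt
  refine ContMDiffAt.comp (z, chartOne n G) (contMDiffAt_extChartAt' ?_) (h1.mul h2)
  rw [← extChartAt_source (𝓡 n)]
  change (extChartAt (𝓡 n) (1 : G)).symm z * (extChartAt (𝓡 n) (1 : G)).symm (chartOne n G) ∈ _
  rw [extChartAt_symm_chartOne, mul_one]
  exact (extChartAt (𝓡 n) (1 : G)).map_target hz

lemma contDiffAt_chartConj {z : EuclideanSpace ℝ (Fin n)}
    (hz : z ∈ (extChartAt (𝓡 n) (1 : G)).target) :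
    ContDiffAt ℝ ∞ (chartConj n G) (z, chartOne n G) := by
  rw [← contMDiffAt_iff_contDiffAt]
  have h1 := (contMDiffAt_extChartAt_symm_one hz).comp (z, chartOne n G)
    (contDiff_fst (𝕜 := ℝ) (n := ∞) (E := EuclideanSpace ℝ (Fin n))
      (F := EuclideanSpace ℝ (Fin n))).contMDiff.contMDiffAt
  have h2 := (contMDiffAt_extChartAt_symm_one (chartOne_mem_target (G := G))).comp
    (z, chartOne n G) (contDiff_snd (𝕜 := ℝ) (n := ∞) (E := EuclideanSpace ℝ (Fin n))
      (F := EuclideanSpace ℝ (Fin n))).contMDiff.contMDiffAt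
  refine ContMDiffAt.comp (z, chartOne n G) (contMDiffAt_extChartAt' ?_) ((h1.mul h2).mul h1.inv)
  rw [← extChartAt_source (𝓡 n)]
  change (extChartAt (𝓡 n) (1 : G)).symm z * (extChartAt (𝓡 n) (1 : G)).symm (chartOne n G) *
    ((extChartAt (𝓡 n) (1 : G)).symm z)⁻¹ ∈ _
  rw [extChartAt_symm_chartOne, mul_one, mul_inv_cancel]
  exact mem_extChartAt_source (1 : G)

lemma fderiv_fderiv_chartConj (u w : EuclideanSpace ℝ (Fin n)) :
    fderiv ℝ (fderiv ℝ (chartConj n G)) (chartOne n G, chartOne n G) (u, 0) (0, w) =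
      fderiv ℝ (fderiv ℝ (chartMul n G)) (chartOne n G, chartOne n G) (u, 0) (0, w) -
      fderiv ℝ (fderiv ℝ (chartMul n G)) (chartOne n G, chartOne n G) (w, 0) (0, u) := by
  refine fderiv_fderiv_conj
    ((contDiffAt_chartMul (G := G) chartOne_mem_target).of_le two_le_infty)
    ((contDiffAt_chartConj (G := G) chartOne_mem_target).of_le two_le_infty)
    ?_ ?_ ?_ ?_ u w
  · filter_upwards [eventually_mem_target (G := G)] with z hz
    simp only [chartMul, extChartAt_symm_chartOne, mul_one]
    exact (extChartAt (𝓡 n) (1 : G)).right_inv hz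
  · filter_upwards [eventually_mem_target (G := G)] with z hz
    simp only [chartConj, extChartAt_symm_chartOne, one_mul, inv_one, mul_one]
    exact (extChartAt (𝓡 n) (1 : G)).right_inv hz
  · filter_upwards with z
    simp only [chartConj, extChartAt_symm_chartOne, mul_one, mul_inv_cancel, chartOne_eq]
  -- The identity `(zyz⁻¹)z = zy` can be read in the chart only where the conjugate stays in the
  -- chart's domain; near the identity continuity ensures this.
  · have h1 : Tendsto (fun p : EuclideanSpace ℝ (Fin n) × EuclideanSpace ℝ (Fin n) =>
        (extChartAt (𝓡 n) (1 : G)).symm p.1 * (extChartAt (𝓡 n) (1 : G)).symm p.2 *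
        ((extChartAt (𝓡 n) (1 : G)).symm p.1)⁻¹) (𝓝 (chartOne n G, chartOne n G)) (𝓝 1) := by
      have hs : Tendsto (extChartAt (𝓡 n) (1 : G)).symm (𝓝 (chartOne n G)) (𝓝 1) := by
        have := (contMDiffAt_extChartAt_symm_one (n := n)
          (chartOne_mem_target (G := G))).continuousAt.tendsto
        rwa [extChartAt_symm_chartOne] at this
      have : IsTopologicalGroup G := topologicalGroup_of_lieGroup (𝓡 n) ∞
      have ha := hs.comp (continuous_fst.tendsto (chartOne n G, chartOne n G))
      have hb := hs.comp (continuous_snd.tendsto (chartOne n G, chartOne n G))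
      simpa using (ha.mul hb).mul ha.inv
    filter_upwards [h1.eventually (extChartAt_source_mem_nhds (I := 𝓡 n) (1 : G))] with p hp
    simp only [chartMul, chartConj]
    rw [(extChartAt (𝓡 n) (1 : G)).left_inv hp]
    simp

end ChartAtOne

/-! ### The derivative of the adjoint action is the bracket. -/

section AdjointDerivative

open Set Filter Topology

variable {n : ℕ} {G : Type*} [TopologicalSpace G] [ChartedSpace (EuclideanSpace ℝ (Fin n)) G]
  [Group G] [LieGroup (𝓡 n) ∞ G]

/-- The adjoint action of a Lie group on its Lie algebra: the derivative of the conjugation. -/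
noncomputable def lieAd (g : G) (Y : EuclideanSpace ℝ (Fin n)) : EuclideanSpace ℝ (Fin n) :=
  mfderiv (𝓡 n) (𝓡 n) (fun h : G => g * h * g⁻¹) 1 Y

variable (n G) in
/-- The bracket of the Lie algebra of `G`, on the model space. -/
noncomputable def groupBracket (X Y : EuclideanSpace ℝ (Fin n)) : EuclideanSpace ℝ (Fin n) :=
  (⁅(show GroupLieAlgebra (𝓡 n) G from X), (show GroupLieAlgebra (𝓡 n) G from Y)⁆ :
    GroupLieAlgebra (𝓡 n) G)

omit [LieGroup (𝓡 n) ∞ G] in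
lemma mfderiv_one_eq_fderiv {f : G → EuclideanSpace ℝ (Fin n)}
    (hf : MDifferentiableAt (𝓡 n) 𝓘(ℝ, EuclideanSpace ℝ (Fin n)) f 1)
    (Y : EuclideanSpace ℝ (Fin n)) :
    mfderiv (𝓡 n) 𝓘(ℝ, EuclideanSpace ℝ (Fin n)) f 1 Y =
      fderiv ℝ (f ∘ (extChartAt (𝓡 n) (1 : G)).symm) (chartOne n G) Y := by
  have h := DFunLike.congr_fun hf.mfderiv Y
  rw [ModelWithCorners.range_eq_univ, fderivWithin_univ] at h
  exact h

lemma lieAd_extChartAt_symm {z : EuclideanSpace ℝ (Fin n)}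
    (hz : z ∈ (extChartAt (𝓡 n) (1 : G)).target) (Y : EuclideanSpace ℝ (Fin n)) :
    lieAd ((extChartAt (𝓡 n) (1 : G)).symm z) Y =
      fderiv ℝ (chartConj n G) (z, chartOne n G) (0, Y) := by
  set g := (extChartAt (𝓡 n) (1 : G)).symm z with hg
  have hf : MDifferentiableAt (𝓡 n) (𝓡 n) (fun h : G => g * h * g⁻¹) 1 :=
    (mdifferentiableAt_mul_right_lieGroup _ _).comp _ (mdifferentiableAt_mul_left_lieGroup _ _)
  have h1 : g * 1 * g⁻¹ = 1 := by simp
  have hD : HasFDerivAt (fun y : EuclideanSpace ℝ (Fin n) => chartConj n G (z, y))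
      ((fderiv ℝ (chartConj n G) (z, chartOne n G)).comp
        (ContinuousLinearMap.inr ℝ (EuclideanSpace ℝ (Fin n)) _)) (chartOne n G) :=
    HasFDerivAt.comp (f := fun y : EuclideanSpace ℝ (Fin n) => (z, y)) _
      ((contDiffAt_chartConj hz).differentiableAt (by simp)).hasFDerivAt
      (hasFDerivAt_prodMk_right z _)
  have h := DFunLike.congr_fun hf.mfderiv Y
  rw [ModelWithCorners.range_eq_univ, fderivWithin_univ] at h
  refine Eq.trans h ?_
  have hw : writtenInExtChartAt (𝓡 n) (𝓡 n) 1 (fun h : G => g * h * g⁻¹) =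
      fun y : EuclideanSpace ℝ (Fin n) => chartConj n G (z, y) := by
    funext y
    simp only [writtenInExtChartAt, h1]
    rfl
  rw [hw]
  exact DFunLike.congr_fun hD.fderiv Y

/-- The field at `g` is the derivative of `h ↦ g * h` at the identity, and pulling back by the
inverse chart is pushing forward by the chart; the chain rule combines the two. -/
lemma mpullbackWithin_mulInvariantVectorField {z : EuclideanSpace ℝ (Fin n)}
    (hz : z ∈ (extChartAt (𝓡 n) (1 : G)).target) (X : EuclideanSpace ℝ (Fin n)) :
    VectorField.mpullbackWithin 𝓘(ℝ, EuclideanSpace ℝ (Fin n)) (𝓡 n)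
      (extChartAt (𝓡 n) (1 : G)).symm (mulInvariantVectorField (I := 𝓡 n) (G := G) X)
      (range (𝓡 n)) z = fderiv ℝ (chartMul n G) (z, chartOne n G) (0, X) := by
  have hM : IsManifold (𝓡 n) 1 G := IsManifold.of_le (n := ∞) (by simp)
  have hinv := ContinuousLinearMap.inverse_eq
    (mfderivWithin_extChartAt_symm_comp_mfderiv_extChartAt (I := 𝓡 n) hz)
    (mfderiv_extChartAt_comp_mfderivWithin_extChartAt_symm (I := 𝓡 n) hz)
  rw [VectorField.mpullbackWithin_apply, hinv]
  set g := (extChartAt (𝓡 n) (1 : G)).symm z with hg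
  have hgs : g ∈ (chartAt (EuclideanSpace ℝ (Fin n)) (1 : G)).source := by
    rw [← extChartAt_source (𝓡 n)]
    exact (extChartAt (𝓡 n) (1 : G)).map_target hz
  have hd := mdifferentiableAt_extChartAt (I := 𝓡 n) hgs
  have key : ∀ g' : G, g * 1 = g' →
      mfderiv (𝓡 n) 𝓘(ℝ, EuclideanSpace ℝ (Fin n))
        (extChartAt (𝓡 n) (1 : G) ∘ fun x => g * x) (1 : G) =
      (mfderiv (𝓡 n) 𝓘(ℝ, EuclideanSpace ℝ (Fin n)) (extChartAt (𝓡 n) (1 : G)) g').comp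
        (mfderiv (𝓡 n) (𝓡 n) (g * ·) (1 : G)) := by
    rintro _ rfl
    refine mfderiv_comp (I' := 𝓡 n) _ ?_ (mdifferentiableAt_mul_left_lieGroup _ _)
    rwa [mul_one]
  have hd' : MDifferentiableAt (𝓡 n) 𝓘(ℝ, EuclideanSpace ℝ (Fin n))
      (extChartAt (𝓡 n) (1 : G) ∘ fun x => g * x) (1 : G) := by
    refine MDifferentiableAt.comp (I' := 𝓡 n) _ ?_ (mdifferentiableAt_mul_left_lieGroup _ _)
    rwa [mul_one]
  have hD : HasFDerivAt (fun y : EuclideanSpace ℝ (Fin n) => chartMul n G (z, y))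
      ((fderiv ℝ (chartMul n G) (z, chartOne n G)).comp
        (ContinuousLinearMap.inr ℝ (EuclideanSpace ℝ (Fin n)) _)) (chartOne n G) :=
    HasFDerivAt.comp (f := fun y : EuclideanSpace ℝ (Fin n) => (z, y)) _
      ((contDiffAt_chartMul hz).differentiableAt (by simp)).hasFDerivAt
      (hasFDerivAt_prodMk_right z _)
  refine Eq.trans (DFunLike.congr_fun (key g (mul_one g)) X).symm ?_
  exact (mfderiv_one_eq_fderiv hd' X).trans (DFunLike.congr_fun hD.fderiv X)

/-- In the chart, the left invariant field of `w` is the partial derivative of `chartMul` in its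
second variable, applied to `w`; its value at the unit is `w`. The formula is the coordinate
expression of the Lie bracket of two such fields. -/
lemma groupBracket_eq_fderiv_fderiv_chartMul (X Y : EuclideanSpace ℝ (Fin n)) :
    groupBracket n G X Y =
      fderiv ℝ (fderiv ℝ (chartMul n G)) (chartOne n G, chartOne n G) (X, 0) (0, Y) -
      fderiv ℝ (fderiv ℝ (chartMul n G)) (chartOne n G, chartOne n G) (Y, 0) (0, X) := by
  have hM : IsManifold (𝓡 n) 1 G := IsManifold.of_le (n := ∞) (by simp)
  have hD := fun w => hasFDerivAt_fderiv_snd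
    ((contDiffAt_chartMul (n := n) (G := G) chartOne_mem_target).of_le two_le_infty) w
  have hev : ∀ w : EuclideanSpace ℝ (Fin n),
      VectorField.mpullbackWithin 𝓘(ℝ, EuclideanSpace ℝ (Fin n)) (𝓡 n)
      (extChartAt (𝓡 n) (1 : G)).symm (mulInvariantVectorField (I := 𝓡 n) (G := G) w)
      (range (𝓡 n)) =ᶠ[𝓝 (chartOne n G)]
      fun z => fderiv ℝ (chartMul n G) (z, chartOne n G) (0, w) := fun w => by
    filter_upwards [eventually_mem_target (G := G)] with z hz
    exact mpullbackWithin_mulInvariantVectorField hz w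
  have hval : ∀ w : EuclideanSpace ℝ (Fin n),
      fderiv ℝ (chartMul n G) (chartOne n G, chartOne n G) (0, w) = w := by
    intro w
    have h1 : HasFDerivAt (fun y : EuclideanSpace ℝ (Fin n) => chartMul n G (chartOne n G, y))
        ((fderiv ℝ (chartMul n G) (chartOne n G, chartOne n G)).comp
          (ContinuousLinearMap.inr ℝ (EuclideanSpace ℝ (Fin n)) _)) (chartOne n G) :=
      HasFDerivAt.comp (f := fun y : EuclideanSpace ℝ (Fin n) => (chartOne n G, y)) _
        ((contDiffAt_chartMul chartOne_mem_target).differentiableAt (by simp)).hasFDerivAt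
        (hasFDerivAt_prodMk_right _ _)
    have h2 : HasFDerivAt (fun y : EuclideanSpace ℝ (Fin n) => chartMul n G (chartOne n G, y))
        (ContinuousLinearMap.id ℝ _) (chartOne n G) := by
      refine (hasFDerivAt_id _).congr_of_eventuallyEq ?_
      filter_upwards [eventually_mem_target (G := G)] with z hz
      simp only [chartMul, extChartAt_symm_chartOne, one_mul]
      exact (extChartAt (𝓡 n) (1 : G)).right_inv hz
    simpa using DFunLike.congr_fun (h1.unique h2) w
  have hb : ∀ V W : EuclideanSpace ℝ (Fin n) → EuclideanSpace ℝ (Fin n),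
      V =ᶠ[𝓝 (chartOne n G)] (fun z => fderiv ℝ (chartMul n G) (z, chartOne n G) (0, X)) →
      W =ᶠ[𝓝 (chartOne n G)] (fun z => fderiv ℝ (chartMul n G) (z, chartOne n G) (0, Y)) →
      VectorField.lieBracketWithin ℝ V W
        ((extChartAt (𝓡 n) (1 : G)).symm ⁻¹' univ ∩ range (𝓡 n)) (chartOne n G) =
      fderiv ℝ (fderiv ℝ (chartMul n G)) (chartOne n G, chartOne n G) (X, 0) (0, Y) -
      fderiv ℝ (fderiv ℝ (chartMul n G)) (chartOne n G, chartOne n G) (Y, 0) (0, X) := by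
    intro V W hV hW
    rw [preimage_univ, ModelWithCorners.range_eq_univ, inter_univ,
      VectorField.lieBracketWithin_univ, Filter.EventuallyEq.lieBracket_vectorField_eq hV hW,
      VectorField.lieBracket, (hD X).fderiv, (hD Y).fderiv, hval X, hval Y]
    rfl
  have hid : (mfderiv (𝓡 n) 𝓘(ℝ, EuclideanSpace ℝ (Fin n)) (extChartAt (𝓡 n) (1 : G)) 1).inverse =
      ContinuousLinearMap.id ℝ _ := by
    rw [mfderiv_extChartAt_self]
    exact ContinuousLinearMap.inverse_id
  rw [groupBracket, GroupLieAlgebra.bracket_def, VectorField.mlieBracket, VectorField.mlieBracketWithin_apply,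
    hid]
  exact hb _ _ (hev X) (hev Y)

lemma lieAd_mul (g h : G) (Y : EuclideanSpace ℝ (Fin n)) :
    lieAd (g * h) Y = lieAd g (lieAd h Y) := by
  have hf : ∀ g h : G, MDifferentiableAt (𝓡 n) (𝓡 n) (fun x : G => g * x * g⁻¹) h := fun g h =>
    (mdifferentiableAt_mul_right_lieGroup _ _).comp _ (mdifferentiableAt_mul_left_lieGroup _ _)
  have key : ∀ g' : G, h * 1 * h⁻¹ = g' →
      mfderiv (𝓡 n) (𝓡 n) ((fun x => g * x * g⁻¹) ∘ fun x => h * x * h⁻¹) (1 : G) =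
      (mfderiv (𝓡 n) (𝓡 n) (fun x => g * x * g⁻¹) g').comp
        (mfderiv (𝓡 n) (𝓡 n) (fun x => h * x * h⁻¹) (1 : G)) := by
    rintro _ rfl
    exact mfderiv_comp (I' := 𝓡 n) _ (hf _ _) (hf _ _)
  have D : (fun x : G => g * h * x * (g * h)⁻¹) =
      (fun x => g * x * g⁻¹) ∘ fun x => h * x * h⁻¹ := by
    ext x; simp [mul_assoc]
  unfold lieAd
  rw [D]
  exact DFunLike.congr_fun (key 1 (by simp)) Y

omit [LieGroup (𝓡 n) ∞ G] in
lemma lieAd_one (Y : EuclideanSpace ℝ (Fin n)) : lieAd (1 : G) Y = Y := by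
  have D : (fun x : G => 1 * x * 1⁻¹) = id := by ext x; simp
  unfold lieAd
  rw [D, mfderiv_id]
  rfl

variable [T2Space G]

variable (G) in
/-- The one-parameter subgroup `t ↦ exp (t X)`. -/
noncomputable def expCurve (X : EuclideanSpace ℝ (Fin n)) (t : ℝ) : G :=
  lieExp (G := G) (t • (show GroupLieAlgebra (𝓡 n) G from X))

lemma isMIntegralCurve_expCurve (X : EuclideanSpace ℝ (Fin n)) :
    IsMIntegralCurve (expCurve G X) (mulInvariantVectorField (I := 𝓡 n) (G := G) X) :=
  isMIntegralCurve_lieExp (G := G) X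

@[simp] lemma expCurve_zero (X : EuclideanSpace ℝ (Fin n)) : expCurve G X 0 = 1 := by
  obtain ⟨γ, h0, hγ⟩ := exists_isMIntegralCurve_mulInvariantVectorField (G := G) X
  exact (lieExp_smul_eq h0 hγ 0).trans h0

lemma expCurve_add (X : EuclideanSpace ℝ (Fin n)) (s t : ℝ) :
    expCurve G X (s + t) = expCurve G X s * expCurve G X t :=
  lieExp_add_smul (G := G) X s t

lemma expCurve_neg (X : EuclideanSpace ℝ (Fin n)) (t : ℝ) :
    expCurve G X (-t) = (expCurve G X t)⁻¹ :=
  lieExp_neg_smul (G := G) X t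

/-- In the chart, `lieAd` is the partial derivative of `chartConj` in its second variable;
differentiating it along the curve gives a mixed second derivative, which `fderiv_fderiv_chartConj`
identifies with the bracket. -/
lemma hasDerivAt_lieAd_expCurve_zero (X Y : EuclideanSpace ℝ (Fin n)) :
    HasDerivAt (fun t : ℝ => lieAd (expCurve G X t) Y) (groupBracket n G X Y) 0 := by
  have hM : IsManifold (𝓡 n) 1 G := IsManifold.of_le (n := ∞) (by simp)
  have h0 := expCurve_zero (G := G) X
  have hγ := isMIntegralCurve_expCurve (G := G) X
  set γ := expCurve G X
  have hX : (show EuclideanSpace ℝ (Fin n) from mulInvariantVectorField (I := 𝓡 n) X (1 : G)) = X := by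
    have D : (fun x : G => 1 * x) = id := by ext x; simp
    unfold mulInvariantVectorField
    rw [D, mfderiv_id]
    rfl
  have hz : HasDerivAt (fun t => extChartAt (𝓡 n) (1 : G) (γ t)) X 0 := by
    have h1 : HasFDerivWithinAt (fun t => extChartAt (𝓡 n) (γ 0) (γ t))
        ((1 : ℝ →L[ℝ] ℝ).smulRight
          (show EuclideanSpace ℝ (Fin n) from mulInvariantVectorField X (γ 0)))
        (range 𝓘(ℝ, ℝ)) 0 := (hγ 0).2
    rw [ModelWithCorners.range_eq_univ, hasFDerivWithinAt_univ, h0, hX] at h1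
    simpa using h1.hasDerivAt
  have hev : (fun t : ℝ => lieAd (expCurve G X t) Y) =ᶠ[𝓝 0] fun t =>
      fderiv ℝ (chartConj n G) (extChartAt (𝓡 n) (1 : G) (γ t), chartOne n G) (0, Y) := by
    have hc : Tendsto γ (𝓝 0) (𝓝 1) := by
      simpa [h0] using hγ.continuous.tendsto 0
    filter_upwards [hc.eventually (extChartAt_source_mem_nhds (I := 𝓡 n) (1 : G))] with t ht
    rw [← lieAd_extChartAt_symm ((extChartAt (𝓡 n) (1 : G)).map_source ht),
      (extChartAt (𝓡 n) (1 : G)).left_inv ht]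
  have hD := hasFDerivAt_fderiv_snd
    ((contDiffAt_chartConj (n := n) (G := G) chartOne_mem_target).of_le two_le_infty) Y
  have hz0 : extChartAt (𝓡 n) (1 : G) (γ 0) = chartOne n G := by rw [h0]; rfl
  rw [← hz0] at hD
  refine ((hD.comp_hasDerivAt (0 : ℝ) hz).congr_of_eventuallyEq ?_).congr_deriv ?_
  · rw [hz0]
    exact hev
  · rw [hz0, groupBracket_eq_fderiv_fderiv_chartMul, ← fderiv_fderiv_chartConj]
    rfl

/-- `Ad(exp sX) = Ad(exp (s - t)X) Ad(exp tX)` reduces this to time zero. -/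
lemma hasDerivAt_lieAd_expCurve (X Y : EuclideanSpace ℝ (Fin n)) (t : ℝ) :
    HasDerivAt (fun t : ℝ => lieAd (expCurve G X t) Y)
      (groupBracket n G X (lieAd (expCurve G X t) Y)) t := by
  have h := hasDerivAt_lieAd_expCurve_zero (G := G) X (lieAd (expCurve G X t) Y)
  have h1 : HasDerivAt (fun s : ℝ => s - t) 1 t := (hasDerivAt_id t).sub_const t
  rw [← sub_self t] at h
  have h2 := HasDerivAt.scomp (h := fun s : ℝ => s - t) t h h1
  rw [one_smul] at h2
  refine h2.congr_of_eventuallyEq (Eventually.of_forall fun s => ?_)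
  simp only [Function.comp]
  rw [← lieAd_mul, ← expCurve_add, sub_add_cancel]

end AdjointDerivative

/-! ### Exponentials of nilpotent elements, as finite sums. -/

section TruncExp

open Filter Topology

/-- The exponential series of `t a`, truncated after `K` terms. -/
noncomputable def truncExp {A : Type*} [Ring A] [Algebra ℝ A] (K : ℕ) (a : A) (t : ℝ) : A :=
  ∑ k ∈ Finset.range K, (t ^ k / (k.factorial : ℝ)) • a ^ k

lemma truncExp_apply {M : Type*} [AddCommGroup M] [Module ℝ M] (K : ℕ) (N : Module.End ℝ M)
    (t : ℝ) (Y : M) :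
    truncExp K N t Y = ∑ k ∈ Finset.range K, (t ^ k / (k.factorial : ℝ)) • (N ^ k) Y := by
  simp [truncExp, LinearMap.sum_apply]

lemma truncExp_clm_apply {E : Type*} [NormedAddCommGroup E] [NormedSpace ℝ E] (K : ℕ)
    (N : E →L[ℝ] E) (t : ℝ) (Y : E) :
    truncExp K N t Y = ∑ k ∈ Finset.range K, (t ^ k / (k.factorial : ℝ)) • (N ^ k) Y := by
  simp [truncExp]

lemma truncExp_coe {E : Type*} [NormedAddCommGroup E] [NormedSpace ℝ E] (K : ℕ)
    (N : E →L[ℝ] E) (t : ℝ) (Y : E) :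
    truncExp K (N : E →ₗ[ℝ] E) t Y = truncExp K N t Y := by
  rw [truncExp_apply, truncExp_clm_apply]
  refine Finset.sum_congr rfl fun k _ => ?_
  rw [Module.End.pow_apply, FunLike.coe_pow_eq_iterate]
  rfl

lemma pow_bilinear_leibniz {U V W : Type*} [AddCommGroup U] [Module ℝ U] [AddCommGroup V]
    [Module ℝ V] [AddCommGroup W] [Module ℝ W] (β : U →ₗ[ℝ] V →ₗ[ℝ] W) (S : Module.End ℝ U)
    (T : Module.End ℝ V) (R : Module.End ℝ W)
    (hR : ∀ u v, R (β u v) = β (S u) v + β u (T v)) (k : ℕ) (u : U) (v : V) :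
    (R ^ k) (β u v) = ∑ p ∈ Finset.HasAntidiagonal.antidiagonal k,
      k.choose p.1 • β ((S ^ p.1) u) ((T ^ p.2) v) := by
  induction k with
  | zero => simp
  | succ k ih =>
    rw [pow_succ', Module.End.mul_apply, ih, map_sum,
      Finset.sum_antidiagonal_choose_succ_nsmul (fun i j => β ((S ^ i) u) ((T ^ j) v)),
      ← Finset.sum_add_distrib]
    refine Finset.sum_congr rfl fun p hp => ?_
    rw [Finset.HasAntidiagonal.mem_antidiagonal] at hp
    rw [map_nsmul, hR, pow_succ', pow_succ', nsmul_add, add_comm,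
      ← Nat.choose_symm_of_eq_add hp.symm]
    rfl

/-- If `R` acts on `β u v` by the Leibniz rule, then its exponential is multiplicative. -/
lemma truncExp_bilinear {U V W : Type*} [AddCommGroup U] [Module ℝ U] [AddCommGroup V]
    [Module ℝ V] [AddCommGroup W] [Module ℝ W] (β : U →ₗ[ℝ] V →ₗ[ℝ] W) (S : Module.End ℝ U)
    (T : Module.End ℝ V) (R : Module.End ℝ W)
    (hR : ∀ u v, R (β u v) = β (S u) v + β u (T v)) {K : ℕ} (hS : S ^ K = 0) (hT : T ^ K = 0)
    (hRK : R ^ K = 0) (t : ℝ) (u : U) (v : V) :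
    truncExp K R t (β u v) = β (truncExp K S t u) (truncExp K T t v) := by
  set F : ℕ × ℕ → W := fun p => ((t ^ p.1 / (p.1.factorial : ℝ)) * (t ^ p.2 / (p.2.factorial : ℝ))) •
    β ((S ^ p.1) u) ((T ^ p.2) v) with hF
  have hF0 : ∀ p, K ≤ p.1 ∨ K ≤ p.2 → F p = 0 := by
    rintro p (h | h)
    · simp [hF, pow_eq_zero_of_le h hS]
    · simp [hF, pow_eq_zero_of_le h hT]
  have hk : ∀ k, (t ^ k / (k.factorial : ℝ)) • (R ^ k) (β u v) =
      ∑ p ∈ Finset.HasAntidiagonal.antidiagonal k, F p := by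
    intro k
    rw [pow_bilinear_leibniz β S T R hR, Finset.smul_sum]
    refine Finset.sum_congr rfl fun p hp => ?_
    rw [Finset.HasAntidiagonal.mem_antidiagonal] at hp
    rw [hF, ← Nat.cast_smul_eq_nsmul ℝ, smul_smul]
    congr 1
    have h1 := congrArg (Nat.cast (R := ℝ)) (Nat.add_choose_mul_factorial_mul_factorial p.1 p.2)
    rw [← Nat.choose_symm_add] at h1
    push_cast at h1
    rw [← hp, div_mul_div_comm, div_mul_eq_mul_div, div_eq_div_iff (by positivity) (by positivity),
      pow_add, ← h1]
    ring
  have hext : truncExp K R t (β u v) = ∑ k ∈ Finset.range (2 * K), ∑ p ∈ Finset.HasAntidiagonal.antidiagonal k,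
      F p := by
    rw [truncExp_apply, Finset.sum_congr rfl fun k _ => (hk k).symm]
    refine Finset.sum_subset (Finset.range_mono (by omega)) fun k _ h2 => ?_
    rw [pow_eq_zero_of_le (by simpa using h2) hRK]
    simp
  have hrect : β (truncExp K S t u) (truncExp K T t v) =
      ∑ p ∈ Finset.range K ×ˢ Finset.range K, F p := by
    rw [truncExp_apply, truncExp_apply, Finset.sum_product]
    simp only [map_sum, LinearMap.sum_apply, map_smul, LinearMap.smul_apply, Finset.smul_sum, smul_smul, hF]
    rw [Finset.sum_comm]
    simp only [mul_comm]
  -- The square of exponents is cut into antidiagonals; the terms of an antidiagonal outside the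
  -- square vanish by nilpotency.
  rw [hext, hrect, ← Finset.sum_fiberwise_of_maps_to (g := fun p : ℕ × ℕ => p.1 + p.2)
    (t := Finset.range (2 * K)) (fun p hp => by simp at hp ⊢; omega)]
  refine Finset.sum_congr rfl fun k _ => (Finset.sum_subset (fun p hp => ?_) fun p h1 h2 => ?_).symm
  · simp at hp ⊢; omega
  · apply hF0
    simp at h1 h2
    by_contra! hc
    exact h2 hc.1 hc.2 h1

/-- Apply `truncExp_bilinear` to the multiplication of `A`, with right multiplication by `a` and
left multiplication by `-a`. The Leibniz operator is then `0`, with exponential `1`; evaluate at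
`(1, 1)`. -/
lemma truncExp_mul_neg {A : Type*} [Ring A] [Algebra ℝ A] {K : ℕ} {a : A} (h : a ^ K = 0) (t : ℝ) :
    truncExp K a t * truncExp K a (-t) = 1 := by
  rcases Nat.eq_zero_or_pos K with rfl | hK
  · have : Subsingleton A := subsingleton_of_zero_eq_one (by simpa using h.symm)
    exact Subsingleton.elim _ _
  have hl : ∀ k (b : A), (LinearMap.mulLeft ℝ b) ^ k = LinearMap.mulLeft ℝ (b ^ k) := fun k b =>
    LinearMap.pow_mulLeft ℝ A b k
  have hr : ∀ k (b : A), (LinearMap.mulRight ℝ b) ^ k = LinearMap.mulRight ℝ (b ^ k) := fun k b =>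
    LinearMap.pow_mulRight ℝ A b k
  have key := truncExp_bilinear (LinearMap.mul ℝ A) (LinearMap.mulRight ℝ a)
    (LinearMap.mulLeft ℝ (-a)) 0 (fun u v => by simp [mul_assoc]) (K := K)
    (by rw [hr, h]; ext; simp) (by rw [hl, neg_pow, h]; ext; simp) (zero_pow hK.ne') t 1 1
  have e1 : truncExp K (LinearMap.mulRight ℝ a) t 1 = truncExp K a t := by
    rw [truncExp_apply, truncExp]
    simp [hr]
  have e2 : truncExp K (LinearMap.mulLeft ℝ (-a)) t 1 = truncExp K a (-t) := by
    rw [truncExp_apply, truncExp]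
    refine Finset.sum_congr rfl fun k _ => ?_
    rw [hl, LinearMap.mulLeft_apply, mul_one, neg_pow t k, neg_pow a k, mul_div_assoc, mul_comm,
      mul_smul]
    congr 1
    rcases Nat.even_or_odd k with hk | hk <;> simp [hk.neg_one_pow]
  have e3 : truncExp K (0 : Module.End ℝ A) t 1 = 1 := by
    obtain ⟨K, rfl⟩ := Nat.exists_eq_succ_of_ne_zero hK.ne'
    rw [truncExp_apply, Finset.sum_range_succ']
    simp
  rw [e1, e2, LinearMap.mul_apply', LinearMap.mul_apply', mul_one, e3] at key
  exact key.symm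

lemma truncExp_zero {A : Type*} [Ring A] [Algebra ℝ A] {K : ℕ} {a : A} (h : a ^ K = 0) :
    truncExp K a 0 = 1 := by
  cases K with
  | zero =>
    have : Subsingleton A := subsingleton_of_zero_eq_one (by simpa using h.symm)
    exact Subsingleton.elim _ _
  | succ K => simp [truncExp, Finset.sum_range_succ']

/-- Differentiating the exponential sum termwise shifts the index; `c K = 0` supplies the missing
top term. At `k = 0` the truncated exponent `k - 1` is harmless because of the factor `k`. -/
lemma sum_deriv_pow_div_factorial {F : Type*} [AddCommGroup F] [Module ℝ F] (c : ℕ → F) {K : ℕ}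
    (h : c K = 0) (t : ℝ) :
    ∑ k ∈ Finset.range K, ((k : ℝ) * t ^ (k - 1) / (k.factorial : ℝ)) • c k =
      ∑ k ∈ Finset.range K, (t ^ k / (k.factorial : ℝ)) • c (k + 1) := by
  cases K with
  | zero => simp
  | succ K =>
    rw [Finset.sum_range_succ', Finset.sum_range_succ, h]
    simp only [Nat.cast_zero, zero_mul, zero_div, zero_smul, add_zero, smul_zero]
    refine Finset.sum_congr rfl fun k _ => ?_
    rw [Nat.add_sub_cancel, Nat.factorial_succ]
    push_cast
    congr 1
    field_simp

lemma hasDerivAt_truncExp {A : Type*} [NormedRing A] [NormedAlgebra ℝ A] {K : ℕ} {a : A}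
    (h : a ^ K = 0) (t : ℝ) : HasDerivAt (truncExp K a) (a * truncExp K a t) t := by
  have h1 : HasDerivAt (fun t : ℝ => ∑ k ∈ Finset.range K, (t ^ k / (k.factorial : ℝ)) • a ^ k)
      (∑ k ∈ Finset.range K, ((k : ℝ) * t ^ (k - 1) / (k.factorial : ℝ)) • a ^ k) t := by
    refine HasDerivAt.fun_sum fun k _ => ?_
    exact ((hasDerivAt_pow k t).div_const _).smul_const _
  rw [sum_deriv_pow_div_factorial (fun k => a ^ k) h] at h1
  refine h1.congr_deriv ?_
  simp [truncExp, Finset.mul_sum, pow_succ']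

end TruncExp

/-! ### The Maurer-Cartan form and its structure equation. -/

section MaurerCartan

open Filter Topology

variable {n : ℕ} {E : Type*} [NormedAddCommGroup E] [NormedSpace ℝ E]

/-- The left Maurer-Cartan form in exponential coordinates of the second type: the derivative of
`x ↦ exp (x_m X_m) ⋯ exp (x_1 X_1)`, translated back to the identity. -/
noncomputable def mcForm (br : E →L[ℝ] E →L[ℝ] E) (X : Fin n → E) (K : ℕ) :
    List (Fin n) → EuclideanSpace ℝ (Fin n) → EuclideanSpace ℝ (Fin n) →L[ℝ] E
  | [], _ => 0
  | i :: l, x => (truncExp K (br (X i)) (-(x i))).comp (mcForm br X K l x) +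
      (EuclideanSpace.proj i : EuclideanSpace ℝ (Fin n) →L[ℝ] ℝ).smulRight (X i)

variable {br : E →L[ℝ] E →L[ℝ] E} {X : Fin n → E} {K : ℕ}

lemma mcForm_cons_apply (i : Fin n) (l : List (Fin n)) (x u : EuclideanSpace ℝ (Fin n)) :
    mcForm br X K (i :: l) x u =
      truncExp K (br (X i)) (-(x i)) (mcForm br X K l x u) + u i • X i := by
  simp [mcForm]

lemma hasFDerivAt_truncExp_neg_proj (hK : ∀ i, br (X i) ^ K = 0) (i : Fin n)
    (x : EuclideanSpace ℝ (Fin n)) :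
    HasFDerivAt (fun x : EuclideanSpace ℝ (Fin n) => truncExp K (br (X i)) (-(x i)))
      ((EuclideanSpace.proj i : EuclideanSpace ℝ (Fin n) →L[ℝ] ℝ).smulRight
        (-(br (X i) * truncExp K (br (X i)) (-(x i))))) x := by
  have h1 : HasDerivAt (fun t : ℝ => truncExp K (br (X i)) (-t))
      (-(br (X i) * truncExp K (br (X i)) (-(x i)))) (x i) := by
    have := (hasDerivAt_truncExp (hK i) (-(x i))).scomp (x i) (hasDerivAt_neg (x i))
    rw [neg_one_smul] at this
    exact this
  have h2 : HasFDerivAt (fun x : EuclideanSpace ℝ (Fin n) => x i)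
    (EuclideanSpace.proj i : EuclideanSpace ℝ (Fin n) →L[ℝ] ℝ) x :=
    (EuclideanSpace.proj i : EuclideanSpace ℝ (Fin n) →L[ℝ] ℝ).hasFDerivAt
  refine (h1.hasFDerivAt.comp x h2).congr_fderiv ?_
  ext
  simp

lemma differentiable_mcForm (hK : ∀ i, br (X i) ^ K = 0) (l : List (Fin n)) :
    Differentiable ℝ (mcForm br X K l) := by
  induction l with
  | nil => exact differentiable_const (0 : EuclideanSpace ℝ (Fin n) →L[ℝ] E)
  | cons i l ih =>
    intro x
    exact ((hasFDerivAt_truncExp_neg_proj hK i x).differentiableAt.clm_comp (ih x)).add_const _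

/-- By the Jacobi identity `br (X i)` is a derivation, so its exponential is an automorphism of the
bracket. -/
lemma truncExp_br (hjac : ∀ u v w, br u (br v w) = br (br u v) w + br v (br u w))
    (hK : ∀ i, br (X i) ^ K = 0) (i : Fin n) (t : ℝ) (u w : E) :
    truncExp K (br (X i)) t (br u w) =
      br (truncExp K (br (X i)) t u) (truncExp K (br (X i)) t w) := by
  have h0 : ((br (X i) : E →L[ℝ] E) : E →ₗ[ℝ] E) ^ K = 0 := by
    rw [← ContinuousLinearMap.toLinearMap_pow, hK]; rfl
  have := truncExp_bilinear (K := K)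
    (LinearMap.mk₂ ℝ (fun u w => br u w) (by simp) (by simp) (by simp) (by simp))
    ((br (X i) : E →L[ℝ] E) : E →ₗ[ℝ] E) ((br (X i) : E →L[ℝ] E) : E →ₗ[ℝ] E)
    ((br (X i) : E →L[ℝ] E) : E →ₗ[ℝ] E) (fun u v => by simpa using hjac (X i) u v)
    h0 h0 h0 t u w
  simpa only [truncExp_coe, LinearMap.mk₂_apply] using this

/-- The Maurer-Cartan equation. -/
lemma fderiv_mcForm_sub (hself : ∀ u, br u u = 0)
    (hjac : ∀ u v w, br u (br v w) = br (br u v) w + br v (br u w))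
    (hK : ∀ i, br (X i) ^ K = 0) (l : List (Fin n)) (x u w : EuclideanSpace ℝ (Fin n)) :
    fderiv ℝ (mcForm br X K l) x u w - fderiv ℝ (mcForm br X K l) x w u =
      - br (mcForm br X K l x u) (mcForm br X K l x w) := by
  induction l with
  | nil =>
    simp [mcForm]
  | cons i l ih =>
    have hd := ((hasFDerivAt_truncExp_neg_proj hK i x).clm_comp
      (differentiable_mcForm hK l x).hasFDerivAt).add_const
      ((EuclideanSpace.proj i : EuclideanSpace ℝ (Fin n) →L[ℝ] ℝ).smulRight (X i))
    have hf : ∀ u w, fderiv ℝ (mcForm br X K (i :: l)) x u w =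
        truncExp K (br (X i)) (-(x i)) (fderiv ℝ (mcForm br X K l) x u w) -
        u i • br (X i) (truncExp K (br (X i)) (-(x i)) (mcForm br X K l x w)) := by
      intro u w
      have := DFunLike.congr_fun (DFunLike.congr_fun hd.fderiv u) w
      refine Eq.trans this ?_
      simp [sub_eq_add_neg]
    rw [hf, hf, mcForm_cons_apply, mcForm_cons_apply]
    have h1 : ∀ a b c d : E, a - b - (c - d) = (a - c) - b + d := fun a b c d => by abel
    -- The automorphism property turns the inductive term into the bracket of the transported
    -- values; the remaining terms are the cross terms with `X i`, matched by antisymmetry.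
    rw [h1, ← map_sub, ih, map_neg, truncExp_br hjac hK]
    have halt : ∀ u w, br u w = - br w u := fun u w => by
      have := hself (u + w)
      simp only [map_add, add_apply, hself, zero_add, add_zero] at this
      exact eq_neg_of_add_eq_zero_right this
    simp only [map_add, map_smul, add_apply, smul_apply, hself,
      smul_zero, add_zero]
    rw [halt (X i) (truncExp K (br (X i)) (-(x i)) (mcForm br X K l x u))]
    simp only [smul_neg]
    abel

end MaurerCartan

/-! ### Directions annihilating a function are closed under brackets. -/

section BracketGenerating

variable {F E : Type*} [NormedAddCommGroup F] [NormedSpace ℝ F] [CompleteSpace F]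
  [NormedAddCommGroup E] [NormedSpace ℝ E]

/-- If `f` is constant along the fields that correspond to `Y` and `Z` under a `1`-form satisfying
the Maurer-Cartan equation, then also along the one that corresponds to `[Y, Z]`. -/
lemma fderiv_inverse_bracket_eq_zero {br : E → E → E} {L : F → F →L[ℝ] E}
    (hL : Differentiable ℝ L) (hinv : ∀ x, (L x).IsInvertible)
    (hmc : ∀ x u w, fderiv ℝ L x u w - fderiv ℝ L x w u = - br (L x u) (L x w))
    {f : F → ℝ} (hf : ContDiff ℝ 2 f) {Y Z : E} (hY : ∀ x, fderiv ℝ f x ((L x).inverse Y) = 0)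
    (hZ : ∀ x, fderiv ℝ f x ((L x).inverse Z) = 0) (x : F) :
    fderiv ℝ f x ((L x).inverse (br Y Z)) = 0 := by
  have hr : ∀ x Y, L x ((L x).inverse Y) = Y := fun x Y => by
    rw [← ContinuousLinearMap.comp_apply, (hinv x).self_comp_inverse]; rfl
  have hd : ∀ Y, DifferentiableAt ℝ (fun x => (L x).inverse Y) x := fun Y =>
    (((hinv x).contDiffAt_map_inverse (n := 1)).differentiableAt (by simp)).comp x (hL x)
      |>.clm_apply (differentiableAt_const Y)
  -- Derivative of `L (L⁻¹ Y) = Y`.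
  have hdL : ∀ Y u, fderiv ℝ L x u ((L x).inverse Y) +
      L x (fderiv ℝ (fun x => (L x).inverse Y) x u) = 0 := by
    intro Y u
    have h1 := (hL x).hasFDerivAt.clm_apply (hd Y).hasFDerivAt
    have h2 : HasFDerivAt (fun y => L y ((L y).inverse Y)) (0 : F →L[ℝ] E) x := by
      simp only [hr]
      exact hasFDerivAt_const Y x
    have h3 := DFunLike.congr_fun (h1.unique h2) u
    simpa [add_comm] using h3
  have hdf : ∀ Y, (∀ x, fderiv ℝ f x ((L x).inverse Y) = 0) → ∀ u,
      fderiv ℝ (fderiv ℝ f) x u ((L x).inverse Y) +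
      fderiv ℝ f x (fderiv ℝ (fun x => (L x).inverse Y) x u) = 0 := by
    intro Y hY u
    have h1 := (((hf.fderiv_right (m := 1) (by norm_num)).differentiable (by simp)) x).hasFDerivAt
      |>.clm_apply (hd Y).hasFDerivAt
    have h2 : HasFDerivAt (fun y => fderiv ℝ f y ((L y).inverse Y)) (0 : F →L[ℝ] ℝ) x := by
      simp only [hY]
      exact hasFDerivAt_const (0 : ℝ) x
    have h3 := DFunLike.congr_fun (h1.unique h2) u
    simpa [add_comm] using h3
  have hsymm : IsSymmSndFDerivAt ℝ f x := hf.contDiffAt.isSymmSndFDerivAt (by simp)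
  have e1 := hdf Y hY ((L x).inverse Z)
  have e2 := hdf Z hZ ((L x).inverse Y)
  rw [hsymm.eq] at e1
  -- Symmetry of the second derivative of `f` cancels the second-order terms, leaving the derivative
  -- of `f` along the Lie bracket of the two fields.
  have e3 : fderiv ℝ f x (fderiv ℝ (fun x => (L x).inverse Y) x ((L x).inverse Z) -
      fderiv ℝ (fun x => (L x).inverse Z) x ((L x).inverse Y)) = 0 := by
    rw [map_sub]; linarith
  -- `L` carries the Lie bracket of the two fields to `br Y Z`: this is the content of the
  -- Maurer-Cartan equation.
  have e4 : L x (fderiv ℝ (fun x => (L x).inverse Z) x ((L x).inverse Y) -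
      fderiv ℝ (fun x => (L x).inverse Y) x ((L x).inverse Z)) = br Y Z := by
    have h1 := hdL Y ((L x).inverse Z)
    have h2 := hdL Z ((L x).inverse Y)
    have h3 := hmc x ((L x).inverse Y) ((L x).inverse Z)
    rw [hr, hr] at h3
    rw [map_sub, eq_neg_of_add_eq_zero_right h1, eq_neg_of_add_eq_zero_right h2,
      ← neg_neg (br Y Z), ← h3]
    abel
  have e5 : (L x).inverse (br Y Z) = fderiv ℝ (fun x => (L x).inverse Z) x ((L x).inverse Y) -
      fderiv ℝ (fun x => (L x).inverse Y) x ((L x).inverse Z) := by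
    rw [← e4, ← ContinuousLinearMap.comp_apply, (hinv x).inverse_comp_self]; rfl
  rw [e5, ← neg_sub, map_neg, e3, neg_zero]

end BracketGenerating

/-! ### Differentiating products of exponentials in a nilpotent action. -/

section PolynomialAction

variable {n : ℕ} {E : Type*} [NormedAddCommGroup E] [NormedSpace ℝ E]
  {M : Type*} [AddCommGroup M] [Module ℝ M]

/-- The composition `exp (x_m N_m) ⋯ exp (x_1 N_1)` of (truncated) exponentials. -/
noncomputable def expAction (N : Fin n → Module.End ℝ M) (K : ℕ) :
    List (Fin n) → EuclideanSpace ℝ (Fin n) → Module.End ℝ M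
  | [], _ => 1
  | i :: l, x => expAction N K l x * truncExp K (N i) (x i)

variable {br : E →L[ℝ] E →L[ℝ] E} {X : Fin n → E} {K : ℕ} {ρ : E →ₗ[ℝ] Module.End ℝ M}

/-- The exponential of `ρ (X i)` conjugates `ρ w` into `ρ` of `exp (t ad X_i) w`. Taking `w = exp
(-t ad X_i) u` gives the rule for moving `ρ u` past it. -/
lemma truncExp_intertwine (hρ : ∀ u w, ρ (br u w) = ρ u * ρ w - ρ w * ρ u)
    (hK : ∀ i, br (X i) ^ K = 0) (hN : ∀ i, ρ (X i) ^ K = 0) (i : Fin n) (t : ℝ) (u : E) (Y : M) :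
    ρ u (truncExp K (ρ (X i)) t Y) =
      truncExp K (ρ (X i)) t (ρ (truncExp K (br (X i)) (-t) u) Y) := by
  have h0 : ((br (X i) : E →L[ℝ] E) : E →ₗ[ℝ] E) ^ K = 0 := by
    rw [← ContinuousLinearMap.toLinearMap_pow, hK]; rfl
  have h1 := truncExp_bilinear (K := K) ρ ((br (X i) : E →L[ℝ] E) : E →ₗ[ℝ] E) (ρ (X i)) (ρ (X i))
    (fun u v => by
      change ρ (X i) (ρ u v) = ρ (br (X i) u) v + ρ u (ρ (X i) v)
      rw [hρ]; simp) h0 (hN i) (hN i) t (truncExp K (br (X i)) (-t) u) Y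
  have h2 : truncExp K (br (X i)) t (truncExp K (br (X i)) (-t) u) = u :=
    DFunLike.congr_fun (truncExp_mul_neg (hK i) t) u
  rw [h1, truncExp_coe, h2]

/-- The matrix coefficients of `x ↦ exp (x_m N_m) ⋯ exp (x_1 N_1)` are differentiable, and their
derivative is given by the Maurer-Cartan form. -/
lemma hasFDerivAt_expAction [FiniteDimensional ℝ E]
    (hρ : ∀ u w, ρ (br u w) = ρ u * ρ w - ρ w * ρ u)
    (hK : ∀ i, br (X i) ^ K = 0) (hN : ∀ i, ρ (X i) ^ K = 0) (l : List (Fin n)) (μ : M →ₗ[ℝ] ℝ)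
    (x : EuclideanSpace ℝ (Fin n)) (Y : M) :
    HasFDerivAt (fun x => μ (expAction (fun i => ρ (X i)) K l x Y))
      (LinearMap.toContinuousLinearMap (μ ∘ₗ expAction (fun i => ρ (X i)) K l x ∘ₗ ρ.flip Y ∘ₗ
        (mcForm br X K l x : EuclideanSpace ℝ (Fin n) →ₗ[ℝ] E))) x := by
  induction l generalizing Y with
  | nil =>
    refine (hasFDerivAt_const (μ Y) x).congr_fderiv ?_
    ext v
    simp [mcForm]
  | cons i l ih =>
    -- Only the head factor is expanded. This leaves a finite sum of products of scalar functions,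
    -- so `M` needs no topology, and the induction hypothesis is used at the vectors `(ρ (X i) ^ k)
    -- Y`.
    have hsum : ∀ x : EuclideanSpace ℝ (Fin n),
        μ (expAction (fun i => ρ (X i)) K (i :: l) x Y) =
        ∑ k ∈ Finset.range K, (x i ^ k / (k.factorial : ℝ)) *
          μ (expAction (fun i => ρ (X i)) K l x ((ρ (X i) ^ k) Y)) := by
      intro x
      rw [expAction, Module.End.mul_apply, truncExp_apply, map_sum, map_sum]
      simp
    simp only [hsum]
    have hp : ∀ k : ℕ, HasFDerivAt (fun x : EuclideanSpace ℝ (Fin n) =>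
        x i ^ k / (k.factorial : ℝ)) (((k : ℝ) * x i ^ (k - 1) / (k.factorial : ℝ)) •
          (EuclideanSpace.proj i : EuclideanSpace ℝ (Fin n) →L[ℝ] ℝ)) x := fun k => by
      have h2 : HasFDerivAt (fun x : EuclideanSpace ℝ (Fin n) => x i)
        (EuclideanSpace.proj i : EuclideanSpace ℝ (Fin n) →L[ℝ] ℝ) x :=
        (EuclideanSpace.proj i : EuclideanSpace ℝ (Fin n) →L[ℝ] ℝ).hasFDerivAt
      have h1 := ((hasDerivAt_pow k (x i)).div_const (k.factorial : ℝ)).hasFDerivAt.comp x h2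
      refine h1.congr_fderiv ?_
      ext v
      simp [mul_comm]
    refine (HasFDerivAt.fun_sum fun k _ => (hp k).mul (ih ((ρ (X i) ^ k) Y))).congr_fderiv ?_
    ext v
    have h3 := sum_deriv_pow_div_factorial
      (fun k => μ (expAction (fun i => ρ (X i)) K l x ((ρ (X i) ^ k) Y))) (K := K)
      (by simp [hN]) (x i)
    have h4 : ∀ u, μ (expAction (fun i => ρ (X i)) K l x (ρ u (truncExp K (ρ (X i)) (x i) Y))) =
        ∑ k ∈ Finset.range K, (x i ^ k / (k.factorial : ℝ)) *
          μ (expAction (fun i => ρ (X i)) K l x (ρ u ((ρ (X i) ^ k) Y))) := by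
      intro u
      rw [truncExp_apply]
      simp only [map_sum, map_smul, smul_eq_mul]
    -- The first summand is the derivative of the other factors, with `ρ` moved past the head
    -- exponential; the second is the derivative of the head exponential, which commutes with `ρ (X
    -- i)`.
    have h5 : μ (expAction (fun i => ρ (X i)) K (i :: l) x (ρ (mcForm br X K (i :: l) x v) Y)) =
        μ (expAction (fun i => ρ (X i)) K l x
          (ρ (mcForm br X K l x v) (truncExp K (ρ (X i)) (x i) Y))) +
        v i * μ (expAction (fun i => ρ (X i)) K l x
          (ρ (X i) (truncExp K (ρ (X i)) (x i) Y))) := by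
      rw [truncExp_intertwine hρ hK hN, mcForm_cons_apply, expAction]
      simp only [map_add, map_smul, LinearMap.add_apply, LinearMap.smul_apply, smul_eq_mul,
        Module.End.mul_apply]
      congr 3
      have hc : Commute (ρ (X i)) (truncExp K (ρ (X i)) (x i)) :=
        Commute.sum_right _ _ _ fun k _ => ((Commute.refl _).pow_right k).smul_right _
      exact congrArg _ (DFunLike.congr_fun hc.eq Y).symm
    change _ = μ (expAction (fun i => ρ (X i)) K (i :: l) x (ρ (mcForm br X K (i :: l) x v) Y))
    rw [h5, h4, h4]
    simp only [smul_eq_mul, pow_succ' (ρ (X i)), Module.End.mul_apply] at h3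
    rw [← h3, Finset.mul_sum]
    simp only [sum_apply, add_apply, smul_apply, smul_eq_mul, LinearMap.coe_toContinuousLinearMap',
      LinearMap.comp_apply, LinearMap.flip_apply, ContinuousLinearMap.coe_coe,
      Finset.sum_add_distrib, show (EuclideanSpace.proj i : EuclideanSpace ℝ (Fin n) →L[ℝ] ℝ) v = v i
        from rfl]
    congr 1
    exact Finset.sum_congr rfl fun k _ => by ring

end PolynomialAction

/-! ### The differential of exponential coordinates of the second type. -/

section SecondKind

open Filter Topology

variable {n : ℕ} {G : Type*} [TopologicalSpace G] [ChartedSpace (EuclideanSpace ℝ (Fin n)) G]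
  [Group G] [LieGroup (𝓡 n) ∞ G]

variable (n G) in
/-- The bracket of the Lie algebra of `G` as a continuous bilinear map on the model space. -/
noncomputable def groupBracketCLM :
    EuclideanSpace ℝ (Fin n) →L[ℝ] EuclideanSpace ℝ (Fin n) →L[ℝ] EuclideanSpace ℝ (Fin n) :=
  LinearMap.toContinuousLinearMap
    (LinearMap.toContinuousLinearMap.toLinearMap ∘ₗ
      LinearMap.mk₂ ℝ (groupBracket n G)
        (fun u v w => add_lie (L := GroupLieAlgebra (𝓡 n) G) (M := GroupLieAlgebra (𝓡 n) G) u v w)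
        (fun c u v => smul_lie (L := GroupLieAlgebra (𝓡 n) G) (M := GroupLieAlgebra (𝓡 n) G) c u v)
        (fun u v w => lie_add (L := GroupLieAlgebra (𝓡 n) G) (M := GroupLieAlgebra (𝓡 n) G) u v w)
        (fun c u v => lie_smul (L := GroupLieAlgebra (𝓡 n) G) (M := GroupLieAlgebra (𝓡 n) G) c u v))

lemma groupBracketCLM_self (u : EuclideanSpace ℝ (Fin n)) : groupBracketCLM n G u u = 0 :=
  lie_self (L := GroupLieAlgebra (𝓡 n) G) u

lemma groupBracketCLM_jacobi (u v w : EuclideanSpace ℝ (Fin n)) :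
    groupBracketCLM n G u (groupBracketCLM n G v w) =
      groupBracketCLM n G (groupBracketCLM n G u v) w +
      groupBracketCLM n G v (groupBracketCLM n G u w) :=
  leibniz_lie (L₁ := GroupLieAlgebra (𝓡 n) G) (L₂ := GroupLieAlgebra (𝓡 n) G)
    (M := GroupLieAlgebra (𝓡 n) G) u v w

variable [T2Space G]

/-- Both sides solve the linear equation `y' = [X, y]` with `y(0) = Y`. -/
lemma lieAd_expCurve_eq_truncExp {X : EuclideanSpace ℝ (Fin n)} {K : ℕ}
    (hK : groupBracketCLM n G X ^ K = 0) (t : ℝ) (Y : EuclideanSpace ℝ (Fin n)) :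
    lieAd (expCurve G X t) Y = truncExp K (groupBracketCLM n G X) t Y := by
  have h1 : ∀ t, HasDerivAt (fun t => lieAd (expCurve G X t) Y)
      (groupBracketCLM n G X (lieAd (expCurve G X t) Y)) t := hasDerivAt_lieAd_expCurve X Y
  have h2 : ∀ t, HasDerivAt (fun t => truncExp K (groupBracketCLM n G X) t Y)
      (groupBracketCLM n G X (truncExp K (groupBracketCLM n G X) t Y)) t := fun t => by
    simpa using (hasDerivAt_truncExp hK t).clm_apply (hasDerivAt_const t Y)
  have h0 : truncExp K (groupBracketCLM n G X) 0 Y = Y := by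
    rw [truncExp_zero hK]
    rfl
  exact congrFun (ODE_solution_unique_univ (v := fun _ => groupBracketCLM n G X) (s := fun _ => Set.univ)
    (K := ‖groupBracketCLM n G X‖₊) (t₀ := 0)
    (fun t => (groupBracketCLM n G X).lipschitz.lipschitzOnWith)
    (fun t => ⟨h1 t, trivial⟩) (fun t => ⟨h2 t, trivial⟩) (by simp [h0, lieAd_one])) t

omit [T2Space G] in
-- Differentiate `a x b = (a b)(b⁻¹ x b)` at `x = 1`.
lemma mfderiv_mul_right_mulInvariantVectorField (a b : G) (A : EuclideanSpace ℝ (Fin n)) :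
    mfderiv (𝓡 n) (𝓡 n) (· * b) a (mulInvariantVectorField (I := 𝓡 n) A a) =
      mulInvariantVectorField (I := 𝓡 n) (lieAd b⁻¹ A) (a * b) := by
  have hC : MDifferentiableAt (𝓡 n) (𝓡 n) (fun h : G => b⁻¹ * h * b⁻¹⁻¹) 1 :=
    (mdifferentiableAt_mul_right_lieGroup _ _).comp _ (mdifferentiableAt_mul_left_lieGroup _ _)
  have D : (fun x => x * b) ∘ (fun x => a * x) =
      (fun x => (a * b) * x) ∘ fun h : G => b⁻¹ * h * b⁻¹⁻¹ := by
    ext x; simp [mul_assoc]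
  have key : ∀ a' c : G, a * 1 = a' → b⁻¹ * 1 * b⁻¹⁻¹ = c →
      (mfderiv (𝓡 n) (𝓡 n) (· * b) a').comp (mfderiv (𝓡 n) (𝓡 n) (a * ·) (1 : G)) =
      (mfderiv (𝓡 n) (𝓡 n) (fun x => (a * b) * x) c).comp
        (mfderiv (𝓡 n) (𝓡 n) (fun h : G => b⁻¹ * h * b⁻¹⁻¹) 1) := by
    rintro _ _ rfl rfl
    have h1 := mfderiv_comp (I' := 𝓡 n) (1 : G) (mdifferentiableAt_mul_right_lieGroup (n := n) b _)
      (mdifferentiableAt_mul_left_lieGroup (n := n) a 1)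
    have h2 := mfderiv_comp (I' := 𝓡 n) (1 : G)
      (mdifferentiableAt_mul_left_lieGroup (n := n) (a * b) _) hC
    refine h1.symm.trans (Eq.trans ?_ h2)
    rw [D]
  exact DFunLike.congr_fun (key a 1 (mul_one a) (by simp)) A

omit [T2Space G] in
/-- The product rule in a Lie group, in terms of left translated derivatives. -/
lemma mfderiv_mul_lieGroup {f g : EuclideanSpace ℝ (Fin n) → G} {x : EuclideanSpace ℝ (Fin n)}
    {A B : EuclideanSpace ℝ (Fin n) → EuclideanSpace ℝ (Fin n)}
    (hf : MDifferentiableAt (𝓡 n) (𝓡 n) f x)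
    (hA : ∀ v : EuclideanSpace ℝ (Fin n),
      mfderiv (𝓡 n) (𝓡 n) f x v = mulInvariantVectorField (I := 𝓡 n) (A v) (f x))
    (hg : MDifferentiableAt (𝓡 n) (𝓡 n) g x)
    (hB : ∀ v : EuclideanSpace ℝ (Fin n),
      mfderiv (𝓡 n) (𝓡 n) g x v = mulInvariantVectorField (I := 𝓡 n) (B v) (g x)) :
    MDifferentiableAt (𝓡 n) (𝓡 n) (fun x => f x * g x) x ∧ ∀ v : EuclideanSpace ℝ (Fin n),
      mfderiv (𝓡 n) (𝓡 n) (fun x => f x * g x) x v =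
      mulInvariantVectorField (I := 𝓡 n) (lieAd (g x)⁻¹ (A v) + B v) (f x * g x) := by
  have hm : MDifferentiableAt ((𝓡 n).prod (𝓡 n)) (𝓡 n) (fun p : G × G => p.1 * p.2) (f x, g x) :=
    (contMDiff_mul (𝓡 n) ∞).mdifferentiableAt (by simp)
  have h1 := hm.hasMFDerivAt.comp x (hf.hasMFDerivAt.prodMk hg.hasMFDerivAt)
  refine ⟨h1.mdifferentiableAt, fun v => ?_⟩
  have h2 := DFunLike.congr_fun h1.mfderiv v
  refine Eq.trans h2 ?_
  refine Eq.trans (mfderiv_prod_eq_add_apply hm) ?_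
  refine Eq.trans (congrArg₂ (fun (a b : EuclideanSpace ℝ (Fin n)) => a + b)
    ((congrArg (mfderiv (𝓡 n) (𝓡 n) (· * g x) (f x)) (hA v)).trans
      (mfderiv_mul_right_mulInvariantVectorField (f x) (g x) (A v)))
    ((congrArg (mfderiv (𝓡 n) (𝓡 n) (f x * ·) (g x)) (hB v)).trans
      (mfderiv_mul_left_mulInvariantVectorField (f x) (g x) (B v)))) ?_
  exact (map_add (mfderiv (𝓡 n) (𝓡 n) (fun h : G => f x * g x * h) 1) _ _).symm

/-- The product `exp (x_m X_m) ⋯ exp (x_1 X_1)` over a list of indices. -/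
noncomputable def expProd (G : Type*) [TopologicalSpace G]
    [ChartedSpace (EuclideanSpace ℝ (Fin n)) G] [Group G]
    (X : Fin n → EuclideanSpace ℝ (Fin n)) :
    List (Fin n) → EuclideanSpace ℝ (Fin n) → G
  | [], _ => 1
  | i :: l, x => expProd G X l x * expCurve G (X i) (x i)

/-- A new right factor `exp(x_i X_i)` contributes its own velocity and transports the previous form
by `Ad` of its inverse: this is the recursion that defines `mcForm`. -/
lemma mfderiv_expProd {X : Fin n → EuclideanSpace ℝ (Fin n)} {K : ℕ}
    (hK : ∀ i, groupBracketCLM n G (X i) ^ K = 0) (l : List (Fin n))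
    (x : EuclideanSpace ℝ (Fin n)) :
    MDifferentiableAt (𝓡 n) (𝓡 n) (expProd G X l) x ∧ ∀ v : EuclideanSpace ℝ (Fin n),
      mfderiv (𝓡 n) (𝓡 n) (expProd G X l) x v =
      mulInvariantVectorField (I := 𝓡 n) (mcForm (groupBracketCLM n G) X K l x v)
        (expProd G X l x) := by
  induction l with
  | nil =>
    refine ⟨mdifferentiableAt_const (c := (1 : G)), fun v => ?_⟩
    have h1 : mfderiv (𝓡 n) (𝓡 n) (fun _ : EuclideanSpace ℝ (Fin n) => (1 : G)) x = 0 :=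
      mfderiv_const
    refine Eq.trans (DFunLike.congr_fun h1 v) ?_
    exact (map_zero (mfderiv (𝓡 n) (𝓡 n) (fun h : G => 1 * h) 1)).symm
  | cons i l ih =>
    have hp : HasMFDerivAt (𝓡 n) 𝓘(ℝ, ℝ) (fun x : EuclideanSpace ℝ (Fin n) => x i) x
        (EuclideanSpace.proj i : EuclideanSpace ℝ (Fin n) →L[ℝ] ℝ) :=
      (EuclideanSpace.proj i : EuclideanSpace ℝ (Fin n) →L[ℝ] ℝ).hasMFDerivAt
    have h1 := HasMFDerivAt.comp x (isMIntegralCurve_expCurve (G := G) (X i) (x i)) hp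
    have h2 := mfderiv_mul_lieGroup ih.1 ih.2 h1.mdifferentiableAt (B := fun v => v i • X i)
      (fun v => by
        refine Eq.trans (DFunLike.congr_fun h1.mfderiv v) ?_
        exact (map_smul (mfderiv (𝓡 n) (𝓡 n) (fun h : G => expCurve G (X i) (x i) * h) 1) (v i)
          (X i)).symm)
    refine ⟨h2.1, fun v => (h2.2 v).trans ?_⟩
    rw [mcForm_cons_apply]
    simp only [Function.comp, ← expCurve_neg, lieAd_expCurve_eq_truncExp (hK i)]
    rfl

omit [LieGroup (𝓡 n) ∞ G] [T2Space G] in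
lemma secondKindExp_eq_expProd (X : Fin n → GroupLieAlgebra (𝓡 n) G) :
    secondKindExp X = expProd G X (List.finRange n) := by
  have h : ∀ l : List (Fin n), ∀ x : EuclideanSpace ℝ (Fin n),
      (l.reverse.map fun i => lieExp (x i • X i)).prod = expProd G X l x := by
    intro l x
    induction l with
    | nil => rfl
    | cons i l ih =>
      rw [List.reverse_cons, List.map_append, List.prod_append, ih]
      simp [expProd, expCurve]
  exact funext (h _)

end SecondKind

/-! ### The degree filtration of a graded Lie algebra. -/

section BasisFiltration

variable {J 𝔭 : Type*} [LieRing 𝔭] [LieAlgebra ℝ 𝔭]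

/-- The decreasing filtration defined by the degrees of the elements of a basis. -/
def basisFiltration (b : Module.Basis J ℝ 𝔭) (d : J → ℤ) (k : ℤ) : Submodule ℝ 𝔭 :=
  Submodule.span ℝ (b '' {j | k ≤ d j})

variable {b : Module.Basis J ℝ 𝔭} {d : J → ℤ} {W : ℤ → Submodule ℝ 𝔭}

lemma mem_basisFiltration_iff {k : ℤ} {y : 𝔭} :
    y ∈ basisFiltration b d k ↔ ∀ j, b.repr y j ≠ 0 → k ≤ d j := by
  rw [basisFiltration, b.mem_span_image]
  constructor
  · intro h j hj
    exact h (by simpa using hj)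
  · intro h j hj
    exact h j (by simpa using hj)

lemma basis_mem_basisFiltration (j : J) {k : ℤ} (h : k ≤ d j) : b j ∈ basisFiltration b d k :=
  Submodule.subset_span ⟨j, h, rfl⟩

lemma basis_mem_basisFiltration_iff (j : J) {k : ℤ} : b j ∈ basisFiltration b d k ↔ k ≤ d j :=
  ⟨fun h => mem_basisFiltration_iff.1 h j (by simp), basis_mem_basisFiltration j⟩

lemma basisFiltration_antitone {k l : ℤ} (h : k ≤ l) :
    basisFiltration b d l ≤ basisFiltration b d k :=
  Submodule.span_mono (Set.image_mono fun _ hj => h.trans hj)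

lemma basisFiltration_eq_bot {s k : ℤ} (hs : ∀ j, d j ≤ s) (h : s < k) :
    basisFiltration b d k = ⊥ := by
  rw [basisFiltration, Set.eq_empty_of_forall_notMem (s := {j | k ≤ d j})]
  · simp
  · intro j hj
    exact absurd (hs j) (not_le.2 (h.trans_le hj))

/-- The part of `y` supported on basis vectors of degree different from `m` lies both in `W m` and
in the sum of the other layers, so it vanishes by independence. -/
lemma degree_eq_of_repr_ne_zero (hW : DirectSum.IsInternal W) (hb : ∀ j, b j ∈ W (d j))
    {m : ℤ} {y : 𝔭} (hy : y ∈ W m) {j : J} (hj : b.repr y j ≠ 0) : d j = m := by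
  classical
  by_contra hne
  set f := b.repr y
  have hmem : ∀ (g : J →₀ ℝ) (S : Submodule ℝ 𝔭), (∀ i ∈ g.support, b i ∈ S) →
      b.repr.symm g ∈ S := by
    intro g S hS
    rw [b.repr_symm_apply, Finsupp.linearCombination_apply]
    exact Submodule.sum_mem _ fun i hi => S.smul_mem _ (hS i hi)
  have hsplit : b.repr.symm (f.filter fun i => d i = m) +
      b.repr.symm (f.filter fun i => ¬ d i = m) = y := by
    rw [← map_add, Finsupp.filter_add_filter_not, b.repr.symm_apply_apply]
  have h1 : b.repr.symm (f.filter fun i => d i = m) ∈ W m := hmem _ _ fun i hi => by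
    rw [Finsupp.support_filter, Finset.mem_filter] at hi
    exact hi.2 ▸ hb i
  have h2 : b.repr.symm (f.filter fun i => ¬ d i = m) ∈ ⨆ k, ⨆ (_ : k ≠ m), W k :=
    hmem _ _ fun i hi => by
      rw [Finsupp.support_filter, Finset.mem_filter] at hi
      exact Submodule.mem_iSup_of_mem (d i) (Submodule.mem_iSup_of_mem hi.2 (hb i))
  have h3 : b.repr.symm (f.filter fun i => ¬ d i = m) ∈ W m := by
    rw [eq_sub_of_add_eq' hsplit]
    exact (W m).sub_mem hy h1
  have h4 := (Submodule.disjoint_def.1 (hW.submodule_iSupIndep m)) _ h3 h2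
  have h5 : f.filter (fun i => ¬ d i = m) = 0 := (LinearEquiv.map_eq_zero_iff _).1 h4
  have h6 : f.filter (fun i => ¬ d i = m) j = f j :=
    Finsupp.filter_apply_pos (fun i => ¬ d i = m) f hne
  rw [h5] at h6
  exact hj h6.symm

lemma grade_le_basisFiltration (hW : DirectSum.IsInternal W) (hb : ∀ j, b j ∈ W (d j)) (m : ℤ) :
    W m ≤ basisFiltration b d m := fun _ hy =>
  mem_basisFiltration_iff.2 fun _ hj => (degree_eq_of_repr_ne_zero hW hb hy hj).ge

lemma lie_mem_basisFiltration (hW : DirectSum.IsInternal W) (hb : ∀ j, b j ∈ W (d j))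
    (hlie : ∀ (i j : ℤ) (x y : 𝔭), x ∈ W i → y ∈ W j → ⁅x, y⁆ ∈ W (i + j)) {k l : ℤ} {x y : 𝔭}
    (hx : x ∈ basisFiltration b d k) (hy : y ∈ basisFiltration b d l) :
    ⁅x, y⁆ ∈ basisFiltration b d (k + l) := by
  induction hx using Submodule.span_induction with
  | zero => simp
  | add x x' _ _ h h' => rw [add_lie]; exact add_mem h h'
  | smul c x _ h => rw [smul_lie]; exact Submodule.smul_mem _ c h
  | mem x hx =>
    obtain ⟨i, hi, rfl⟩ := hx
    induction hy using Submodule.span_induction with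
    | zero => simp
    | add y y' _ _ h h' => rw [lie_add]; exact add_mem h h'
    | smul c y _ h => rw [lie_smul]; exact Submodule.smul_mem _ c h
    | mem y hy =>
      obtain ⟨j, hj, rfl⟩ := hy
      exact basisFiltration_antitone (add_le_add hi hj)
        (grade_le_basisFiltration hW hb _ (hlie _ _ _ _ (hb i) (hb j)))

end BasisFiltration

/-! ### Degrees in the Tanaka prolongation and the first layer. -/

section Prolongation

variable {n : ℕ} {𝔤 : Type*} [LieRing 𝔤] [LieAlgebra ℝ 𝔤] {V : ℕ → Submodule ℝ 𝔤}
  {𝔭 : Type*} [LieRing 𝔭] [LieAlgebra ℝ 𝔭] {W : ℤ → Submodule ℝ 𝔭} {ι : 𝔤 →ₗ⁅ℝ⁆ 𝔭}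
  {J : Set ℤ} {hJ : Set.Icc 1 (n : ℤ) ⊆ J} {X : Module.Basis (Fin n) ℝ 𝔤}
  {b : Module.Basis J ℝ 𝔭} {d : J → ℤ}

lemma IsStratification.iSup_eq_top (hV : IsStratification V) : ⨆ k, V k = ⊤ :=
  hV.isInternal.submodule_iSup_eq_top

/-- A submodule that is closed under brackets with the first layer and contains the first layer
is everything. -/
lemma IsStratification.eq_top_of_forall_lie_mem (hV : IsStratification V) {S : Submodule ℝ 𝔤}
    (h1 : V 1 ≤ S) (hS : ∀ x ∈ S, ∀ y ∈ S, ⁅x, y⁆ ∈ S) : S = ⊤ := by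
  rw [eq_top_iff, ← hV.iSup_eq_top]
  refine iSup_le fun k => ?_
  rcases Nat.eq_zero_or_pos k with rfl | hk
  · rw [hV.zero_eq_bot]; exact bot_le
  · induction k, hk using Nat.le_induction with
    | base => exact h1
    | succ k hk ih =>
      rw [hV.succ_eq_span k hk, Submodule.span_le]
      rintro _ ⟨x, hx, y, hy, rfl⟩
      exact hS x (ih hx) y (h1 hy)

/-- Beyond the step of the stratification, `pos_part` makes `W` the image of a zero layer, which
contains no basis vector. -/
lemma IsTanakaProlongation.exists_degree_le (hV : IsStratification V)
    (hP : IsTanakaProlongation V W ι) (hbd : ∀ j : J, b j ∈ W (d j)) : ∃ s : ℤ, ∀ j, d j ≤ s := by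
  obtain ⟨s, hs⟩ := hV.eq_bot_of_gt
  refine ⟨s, fun j => ?_⟩
  by_contra! h
  have h1 := hP.pos_part (d j).toNat (by omega)
  rw [Int.toNat_of_nonneg (by omega), hs _ (by omega), Submodule.map_bot] at h1
  have h2 := hbd j
  rw [h1] at h2
  exact b.ne_zero j (by simpa using h2)

lemma IsTanakaProlongation.map_mem_basisFiltration_one (hV : IsStratification V)
    (hP : IsTanakaProlongation V W ι) (hbd : ∀ j : J, b j ∈ W (d j)) (u : 𝔤) :
    ι u ∈ basisFiltration b d 1 := by
  have h : ⨆ k, V k ≤ (basisFiltration b d 1).comap (ι : 𝔤 →ₗ[ℝ] 𝔭) := by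
    refine iSup_le fun k => ?_
    rcases Nat.eq_zero_or_pos k with rfl | hk
    · rw [hV.zero_eq_bot]; exact bot_le
    · intro x hx
      have h1 : ι x ∈ W (k : ℤ) := by
        rw [hP.pos_part k hk]
        exact Submodule.mem_map_of_mem hx
      exact basisFiltration_antitone (by omega)
        (grade_le_basisFiltration hP.isInternal hbd _ h1)
  rw [hV.iSup_eq_top] at h
  exact h (Submodule.mem_top (x := u))

/-- This shift by one is the source of all the nilpotency in the proof. -/
lemma IsTanakaProlongation.lie_mem_basisFiltration_add_one (hV : IsStratification V)
    (hP : IsTanakaProlongation V W ι) (hbd : ∀ j : J, b j ∈ W (d j)) (u : 𝔤) {k : ℤ} {y : 𝔭}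
    (hy : y ∈ basisFiltration b d k) : ⁅ι u, y⁆ ∈ basisFiltration b d (k + 1) := by
  rw [add_comm]
  exact lie_mem_basisFiltration hP.isInternal hbd hP.lie_mem
    (hP.map_mem_basisFiltration_one hV hbd u) hy

lemma posIndex_injective (hJ : Set.Icc 1 (n : ℤ) ⊆ J) : Function.Injective (posIndex hJ) := by
  intro i j h
  have := congrArg Subtype.val h
  simp only [posIndex] at this
  exact Fin.ext (by omega)

lemma repr_map_posIndex (hXb : ∀ i : Fin n, ι (X i) = b (posIndex hJ i)) (u : 𝔤) (i : Fin n) :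
    b.repr (ι u) (posIndex hJ i) = X.repr u i := by
  conv_lhs => rw [← X.sum_repr u]
  simp only [map_sum, map_smul, hXb, Finsupp.coe_finsetSum, Finset.sum_apply]
  simp only [Module.Basis.repr_self, Finsupp.smul_apply, smul_eq_mul]
  rw [Finset.sum_eq_single i]
  · simp
  · intro j _ hj
    rw [Finsupp.single_eq_of_ne (fun h => hj (posIndex_injective hJ h).symm), mul_zero]
  · simp

lemma IsTanakaProlongation.one_le_degree (hV : IsStratification V)
    (hP : IsTanakaProlongation V W ι) (hXb : ∀ i : Fin n, ι (X i) = b (posIndex hJ i))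
    (hbd : ∀ j : J, b j ∈ W (d j)) (i : Fin n) : 1 ≤ d (posIndex hJ i) := by
  have := hP.map_mem_basisFiltration_one hV hbd (X i)
  rw [hXb] at this
  exact (basis_mem_basisFiltration_iff _).1 this

/-- The first layer is spanned by the first `dim V₁` elements of the basis. -/
lemma IsTanakaProlongation.first_layer_le_span (hV : IsStratification V)
    (hP : IsTanakaProlongation V W ι) (hXb : ∀ i : Fin n, ι (X i) = b (posIndex hJ i))
    (hd : Monotone d) (hbd : ∀ j : J, b j ∈ W (d j)) :
    V 1 ≤ Submodule.span ℝ (X '' {i | (i : ℕ) < Module.finrank ℝ (V 1)}) := by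
  classical
  have h1 : V 1 = Submodule.span ℝ (X '' {i | d (posIndex hJ i) = 1}) := by
    apply le_antisymm
    · intro u hu
      rw [X.mem_span_image]
      intro i hi
      have h1 : ι u ∈ W 1 := by
        have := hP.pos_part 1 le_rfl
        rw [Nat.cast_one] at this
        rw [this]
        exact Submodule.mem_map_of_mem hu
      refine degree_eq_of_repr_ne_zero hP.isInternal hbd h1 ?_
      rw [repr_map_posIndex hXb]
      simpa using hi
    · rw [Submodule.span_le]
      rintro _ ⟨i, hi, rfl⟩
      have h1 := hbd (posIndex hJ i)
      rw [show d (posIndex hJ i) = 1 from hi, ← hXb] at h1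
      have := hP.pos_part 1 le_rfl
      rw [Nat.cast_one] at this
      rw [this] at h1
      obtain ⟨u, hu, hui⟩ := h1
      rwa [hP.injective hui] at hu
  have h2 : Module.finrank ℝ (V 1) = (Finset.univ.filter fun i => d (posIndex hJ i) = 1).card := by
    rw [h1, Set.image_eq_range]
    refine (finrank_span_eq_card (X.linearIndependent.comp
      (fun x : {i | d (posIndex hJ i) = 1} => (x : Fin n)) Subtype.val_injective)).trans ?_
    exact Fintype.card_subtype _
  conv_lhs => rw [h1]
  refine Submodule.span_mono (Set.image_mono fun i hi => ?_)
  change (i : ℕ) < _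
  rw [h2]
  -- The degrees of `X_1, …, X_n` are at least `1` and weakly increasing, so every index up to `i`
  -- also has degree `1`. Hence `i + 1` is at most the number of such indices, which is `dim V 1`.
  have h3 : Finset.Iic i ⊆ Finset.univ.filter fun i => d (posIndex hJ i) = 1 := by
    intro i' hi'
    rw [Finset.mem_Iic] at hi'
    rw [Finset.mem_filter]
    refine ⟨Finset.mem_univ _, le_antisymm ?_ (hP.one_le_degree hV hXb hbd i')⟩
    rw [← show d (posIndex hJ i) = 1 from hi]
    apply hd
    change ((i' : ℕ) : ℤ) + 1 ≤ ((i : ℕ) : ℤ) + 1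
    have : (i' : ℕ) ≤ i := hi'
    omega
  have := Finset.card_le_card h3
  rw [Fin.card_Iic] at this
  omega

end Prolongation

/-! ### The nilpotent action on one step of the filtration. -/

section FilteredAction

variable {E : Type*} [AddCommGroup E] [Module ℝ E] {𝔭 : Type*} [LieRing 𝔭] [LieAlgebra ℝ 𝔭]

/-- The action of `E` by brackets on a submodule of `𝔭` that is stable under it. -/
def adRestrict (ι : E →ₗ[ℝ] 𝔭) (S : Submodule ℝ 𝔭) (hS : ∀ u, ∀ y ∈ S, ⁅ι u, y⁆ ∈ S) :
    E →ₗ[ℝ] Module.End ℝ S :=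
  LinearMap.mk₂ ℝ (fun u Y => ⟨⁅ι u, (Y : 𝔭)⁆, hS u Y Y.2⟩)
    (fun u w Y => Subtype.ext (by simp)) (fun c u Y => Subtype.ext (by simp))
    (fun u Y Z => Subtype.ext (by simp)) (fun c u Y => Subtype.ext (by simp))

variable {ι : E →ₗ[ℝ] 𝔭}

lemma coe_adRestrict_apply {S : Submodule ℝ 𝔭} (hS : ∀ u, ∀ y ∈ S, ⁅ι u, y⁆ ∈ S) (u : E) (Y : S) :
    (adRestrict ι S hS u Y : 𝔭) = ⁅ι u, (Y : 𝔭)⁆ := rfl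

lemma coe_adRestrict_pow_apply {S : Submodule ℝ 𝔭} (hS : ∀ u, ∀ y ∈ S, ⁅ι u, y⁆ ∈ S) (u : E)
    (k : ℕ) (Y : S) :
    ((adRestrict ι S hS u ^ k) Y : 𝔭) = (fun Z => ⁅ι u, Z⁆)^[k] (Y : 𝔭) := by
  induction k with
  | zero => rfl
  | succ k ih =>
    rw [pow_succ', Module.End.mul_apply, coe_adRestrict_apply, ih, Function.iterate_succ_apply']

lemma adRestrict_bracket {S : Submodule ℝ 𝔭} (hS : ∀ u, ∀ y ∈ S, ⁅ι u, y⁆ ∈ S) {u w z : E}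
    (h : ι z = ⁅ι u, ι w⁆) :
    adRestrict ι S hS z =
      adRestrict ι S hS u * adRestrict ι S hS w - adRestrict ι S hS w * adRestrict ι S hS u := by
  ext Y
  simp only [LinearMap.sub_apply, Module.End.mul_apply, AddSubgroupClass.coe_sub,
    coe_adRestrict_apply, h]
  rw [lie_lie]

variable {F : ℤ → Submodule ℝ 𝔭}

lemma iterate_lie_mem_filtration (hF : ∀ u k, ∀ y ∈ F k, ⁅ι u, y⁆ ∈ F (k + 1)) (u : E) {m : ℤ}
    {y : 𝔭} (hy : y ∈ F m) (k : ℕ) : (fun Z => ⁅ι u, Z⁆)^[k] y ∈ F (m + k) := by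
  induction k with
  | zero => simpa using hy
  | succ k ih =>
    rw [Function.iterate_succ_apply', Nat.cast_succ, ← add_assoc]
    exact hF u _ _ ih

/-- On all of `𝔭` the operator need not be nilpotent, as degrees may be unbounded below. Starting
from `F m`, however, `K` brackets lead into `F (m + K) = ⊥`. -/
lemma adRestrict_pow_eq_zero (hF : ∀ u k, ∀ y ∈ F k, ⁅ι u, y⁆ ∈ F (k + 1)) {m : ℤ}
    (hS : ∀ u, ∀ y ∈ F m, ⁅ι u, y⁆ ∈ F m) {K : ℕ} (hK : F (m + K) = ⊥) (u : E) :
    adRestrict ι (F m) hS u ^ K = 0 := by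
  ext Y
  have := iterate_lie_mem_filtration hF u Y.2 K
  rw [hK, Submodule.mem_bot] at this
  rw [coe_adRestrict_pow_apply, this]
  rfl

end FilteredAction

/-! ### Invertibility of the Maurer-Cartan form. -/

section Invertibility

variable {n : ℕ} {E : Type*} [NormedAddCommGroup E] [NormedSpace ℝ E]
  {br : E →L[ℝ] E →L[ℝ] E} {𝔭 : Type*} [LieRing 𝔭] [LieAlgebra ℝ 𝔭] {ι : E →ₗ[ℝ] 𝔭}
  {F : ℤ → Submodule ℝ 𝔭}

lemma map_bracket_pow (hι : ∀ u w, ι (br u w) = ⁅ι u, ι w⁆) (u w : E) (k : ℕ) :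
    ι ((br u ^ k) w) = (fun Z => ⁅ι u, Z⁆)^[k] (ι w) := by
  induction k with
  | zero => rfl
  | succ k ih =>
    rw [pow_succ', Function.iterate_succ_apply', ← ih, ← hι]
    rfl

lemma bracket_pow_eq_zero (hι : ∀ u w, ι (br u w) = ⁅ι u, ι w⁆) (hinj : Function.Injective ι)
    (hF : ∀ u k, ∀ y ∈ F k, ⁅ι u, y⁆ ∈ F (k + 1)) {m : ℤ} (hm : ∀ u, ι u ∈ F m) {K : ℕ}
    (hK : F (m + K) = ⊥) (u : E) : br u ^ K = 0 := by
  ext w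
  have := iterate_lie_mem_filtration hF u (hm w) K
  rw [hK, Submodule.mem_bot, ← map_bracket_pow hι] at this
  exact hinj (this.trans (map_zero ι).symm)

/-- Every term of the exponential beyond the constant one contains a bracket with `u`; `1 ≤ K`
ensures that the constant term is present. -/
lemma map_truncExp_sub_mem (hι : ∀ u w, ι (br u w) = ⁅ι u, ι w⁆) (hanti : Antitone F)
    (hF : ∀ u k, ∀ y ∈ F k, ⁅ι u, y⁆ ∈ F (k + 1)) {K : ℕ} (hK : 1 ≤ K) (u : E) (t : ℝ) {w : E}
    {k : ℤ} (hw : ι w ∈ F k) : ι (truncExp K (br u) t w - w) ∈ F (k + 1) := by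
  obtain ⟨K, rfl⟩ := Nat.exists_eq_add_of_le' hK
  rw [truncExp_clm_apply, Finset.sum_range_succ']
  simp only [pow_zero, Nat.factorial_zero, Nat.cast_one, div_one, one_smul,
    one_apply_eq_self, add_sub_cancel_right, map_sum, map_smul]
  refine Submodule.sum_mem _ fun i _ => Submodule.smul_mem _ _ ?_
  rw [map_bracket_pow hι]
  exact hanti (by push_cast; omega) (iterate_lie_mem_filtration hF u hw (i + 1))

/-- The Maurer-Cartan form is triangular with respect to the filtration. -/
lemma map_mcForm_sub_mem {X : Fin n → E} (hι : ∀ u w, ι (br u w) = ⁅ι u, ι w⁆)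
    (hanti : Antitone F) (hF : ∀ u k, ∀ y ∈ F k, ⁅ι u, y⁆ ∈ F (k + 1)) {K : ℕ} (hK : 1 ≤ K)
    {v : EuclideanSpace ℝ (Fin n)} {k : ℤ} (hv : ∀ i, v i ≠ 0 → ι (X i) ∈ F k)
    (x : EuclideanSpace ℝ (Fin n)) (l : List (Fin n)) :
    ι (mcForm br X K l x v - (l.map fun i => v i • X i).sum) ∈ F (k + 1) := by
  have hvX : ∀ i, ι (v i • X i) ∈ F k := fun i => by
    rw [map_smul]
    by_cases h : v i = 0
    · rw [h, zero_smul]; exact zero_mem _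
    · exact Submodule.smul_mem _ _ (hv i h)
  have hsum : ∀ l : List (Fin n), ι (l.map fun i => v i • X i).sum ∈ F k := by
    intro l
    induction l with
    | nil => simp
    | cons i l ih =>
      rw [List.map_cons, List.sum_cons, map_add]
      exact add_mem (hvX i) ih
  induction l with
  | nil => simp [mcForm]
  | cons i l ih =>
    have h1 : ι (mcForm br X K l x v) ∈ F k := by
      rw [← sub_add_cancel (mcForm br X K l x v) (l.map fun i => v i • X i).sum, map_add]
      exact add_mem (hanti (by omega) ih) (hsum l)
    have h2 := add_mem (map_truncExp_sub_mem hι hanti hF hK (X i) (-(x i)) h1) ih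
    rw [← map_add] at h2
    rw [mcForm_cons_apply, List.map_cons, List.sum_cons]
    convert h2 using 2
    abel

/-- If `v` is in the kernel and its support lies in `F k`, then by triangularity `∑ v_i X_i` lies in
`F (k + 1)`, hence so does the support. Iterating up to `F s = ⊥` gives `v = 0`, and the dimensions
agree. -/
lemma mcForm_isInvertible [FiniteDimensional ℝ E] (X : Module.Basis (Fin n) ℝ E)
    (hι : ∀ u w, ι (br u w) = ⁅ι u, ι w⁆) (hanti : Antitone F)
    (hF : ∀ u k, ∀ y ∈ F k, ⁅ι u, y⁆ ∈ F (k + 1)) {K : ℕ} (hK : 1 ≤ K) {s : ℤ} (hbot : F s = ⊥)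
    (hX : ∀ u k, ι u ∈ F k → ∀ i, X.repr u i ≠ 0 → ι (X i) ∈ F k) (hinj : Function.Injective ι)
    {m : ℤ} (hm : ∀ u, ι u ∈ F m) (x : EuclideanSpace ℝ (Fin n)) :
    (mcForm br X K (List.finRange n) x).IsInvertible := by
  have hker : ∀ v, mcForm br X K (List.finRange n) x v = 0 → v = 0 := by
    intro v hv
    have hsum : ((List.finRange n).map fun i => v i • X i).sum = ∑ i, v i • X i := by
      rw [← List.ofFn_eq_map, List.sum_ofFn]
    have key : ∀ (N : ℕ) (i), v i ≠ 0 → ι (X i) ∈ F (m + N) := by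
      intro N
      induction N with
      | zero => intro i _; simpa using hm _
      | succ N ih =>
        intro i hi
        have h1 := map_mcForm_sub_mem hι hanti hF hK ih x (List.finRange n)
        rw [hv, zero_sub, map_neg, neg_mem_iff, hsum] at h1
        have h2 := hX _ _ h1 i (by
          rw [← X.equivFun_symm_apply, ← X.equivFun_apply, LinearEquiv.apply_symm_apply]
          exact hi)
        rwa [Nat.cast_succ, ← add_assoc]
    ext i
    by_contra hi
    have h1 := hanti (show s ≤ m + ((s - m).toNat : ℤ) by omega) (key (s - m).toNat i hi)
    rw [hbot, Submodule.mem_bot] at h1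
    exact X.ne_zero i (hinj (h1.trans (map_zero ι).symm))
  have hdim : Module.finrank ℝ (EuclideanSpace ℝ (Fin n)) = Module.finrank ℝ E := by
    rw [finrank_euclideanSpace, Module.finrank_eq_card_basis X]
  refine ⟨(LinearEquiv.ofInjectiveOfFinrankEq
    (mcForm br X K (List.finRange n) x : EuclideanSpace ℝ (Fin n) →ₗ[ℝ] E)
    ((injective_iff_map_eq_zero _).2 hker) hdim).toContinuousLinearEquiv, ?_⟩
  ext v
  rfl

end Invertibility

/-! ### Left invariant fields in coordinates. -/

section Coordinates

variable {n : ℕ} {G : Type*} [TopologicalSpace G] [ChartedSpace (EuclideanSpace ℝ (Fin n)) G]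
  [Group G] [LieGroup (𝓡 n) ∞ G]

lemma mulInvariantVectorField_eq_zero {u : EuclideanSpace ℝ (Fin n)} {g : G}
    (h : (mulInvariantVectorField (I := 𝓡 n) u g : EuclideanSpace ℝ (Fin n)) = 0) : u = 0 := by
  have h1 := mfderiv_mul_left_mulInvariantVectorField g⁻¹ g u
  have h2 : (mulInvariantVectorField (I := 𝓡 n) u (g⁻¹ * g) : EuclideanSpace ℝ (Fin n)) = 0 :=
    h1.symm.trans ((congrArg (mfderiv (𝓡 n) (𝓡 n) (g⁻¹ * ·) g) h).trans
      (map_zero (mfderiv (𝓡 n) (𝓡 n) (g⁻¹ * ·) g)))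
  rw [inv_mul_cancel] at h2
  have key : ∀ f : G → G, f = id → (mfderiv (𝓡 n) (𝓡 n) f 1 u : EuclideanSpace ℝ (Fin n)) = u := by
    rintro _ rfl
    exact DFunLike.congr_fun (mfderiv_id (I := 𝓡 n) (x := (1 : G))) u
  exact (key _ (funext one_mul)).symm.trans h2

variable [T2Space G] {X : Fin n → EuclideanSpace ℝ (Fin n)} {K : ℕ}

lemma mfderiv_secondKindExp (hK : ∀ i, groupBracketCLM n G (X i) ^ K = 0)
    (x v : EuclideanSpace ℝ (Fin n)) :
    mfderiv (𝓡 n) (𝓡 n) (secondKindExp (G := G) X) x v = mulInvariantVectorField (I := 𝓡 n)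
      (mcForm (groupBracketCLM n G) X K (List.finRange n) x v) (secondKindExp (G := G) X x) := by
  have key : ∀ Φ : EuclideanSpace ℝ (Fin n) → G, Φ = expProd G X (List.finRange n) →
      mfderiv (𝓡 n) (𝓡 n) Φ x v = mulInvariantVectorField (I := 𝓡 n)
        (mcForm (groupBracketCLM n G) X K (List.finRange n) x v) (Φ x) := by
    rintro _ rfl
    exact (mfderiv_expProd hK (List.finRange n) x).2 v
  exact key _ (secondKindExp_eq_expProd X)

lemma mfderiv_secondKindExp_isInvertible (hK : ∀ i, groupBracketCLM n G (X i) ^ K = 0)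
    (hinv : ∀ x, (mcForm (groupBracketCLM n G) X K (List.finRange n) x).IsInvertible)
    (x : EuclideanSpace ℝ (Fin n)) :
    (mfderiv (𝓡 n) (𝓡 n) (secondKindExp (G := G) X) x).IsInvertible := by
  let D : EuclideanSpace ℝ (Fin n) →L[ℝ] EuclideanSpace ℝ (Fin n) :=
    mfderiv (𝓡 n) (𝓡 n) (secondKindExp (G := G) X) x
  have hker : ∀ v, D v = 0 → v = 0 := by
    intro v hv
    have h1 := mulInvariantVectorField_eq_zero ((mfderiv_secondKindExp hK x v).symm.trans hv)
    obtain ⟨e, he⟩ := hinv x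
    rw [← he] at h1
    exact (ContinuousLinearEquiv.map_eq_zero_iff e).1 h1
  change D.IsInvertible
  refine ⟨(LinearEquiv.ofInjectiveEndo (D : _ →ₗ[ℝ] EuclideanSpace ℝ (Fin n))
    ((injective_iff_map_eq_zero _).2 hker)).toContinuousLinearEquiv, ?_⟩
  ext v
  rfl

/-- By `mfderiv_secondKindExp`, the differential sends `ω⁻¹ Y` to the value of the field `Y`. Its
invertibility is essential, since `inverse` is zero otherwise. -/
lemma coordField_eq_inverse (hK : ∀ i, groupBracketCLM n G (X i) ^ K = 0)
    (hinv : ∀ x, (mcForm (groupBracketCLM n G) X K (List.finRange n) x).IsInvertible)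
    (Y x : EuclideanSpace ℝ (Fin n)) :
    coordField (G := G) X Y x =
      (mcForm (groupBracketCLM n G) X K (List.finRange n) x).inverse Y := by
  have h1 := mfderiv_secondKindExp hK x
    ((mcForm (groupBracketCLM n G) X K (List.finRange n) x).inverse Y)
  have h2 : mcForm (groupBracketCLM n G) X K (List.finRange n) x
      ((mcForm (groupBracketCLM n G) X K (List.finRange n) x).inverse Y) = Y := by
    rw [← ContinuousLinearMap.comp_apply, (hinv x).self_comp_inverse]; rfl
  rw [h2] at h1
  have h3 := mfderiv_secondKindExp_isInvertible hK hinv x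
  refine Eq.trans (congrArg (mfderiv (𝓡 n) (𝓡 n) (secondKindExp (G := G) X) x).inverse h1.symm) ?_
  exact DFunLike.congr_fun h3.inverse_comp_self _

end Coordinates

/-! ### Expanding the product of exponentials into monomials. -/

section PowProd

variable {n : ℕ} {M : Type*} [AddCommGroup M] [Module ℝ M]

/-- The ordered product `N_m ^ a_m ⋯ N_1 ^ a_1`. -/
def powProd (N : Fin n → Module.End ℝ M) (a : Fin n → ℕ) : Module.End ℝ M :=
  ((List.finRange n).reverse.map fun i => N i ^ a i).prod

lemma powProd_eq_zero {N : Fin n → Module.End ℝ M} {K : ℕ} (hN : ∀ i, N i ^ K = 0)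
    {a : Fin n → ℕ} {i : Fin n} (hi : K ≤ a i) : powProd N a = 0 := by
  apply List.prod_eq_zero
  rw [List.mem_map]
  exact ⟨i, by simp, pow_eq_zero_of_le hi (hN i)⟩

lemma expAction_eq_prod (N : Fin n → Module.End ℝ M) (K : ℕ) (l : List (Fin n))
    (x : EuclideanSpace ℝ (Fin n)) :
    expAction N K l x = (l.reverse.map fun i => truncExp K (N i) (x i)).prod := by
  induction l with
  | nil => rfl
  | cons i l ih =>
    rw [List.reverse_cons, List.map_append, List.prod_append, ← ih]
    simp [expAction]

lemma expAction_finRange (N : Fin n → Module.End ℝ M) (K : ℕ) (x : EuclideanSpace ℝ (Fin n)) :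
    expAction N K (List.finRange n) x =
      ∑ a ∈ Fintype.piFinset fun _ : Fin n => Finset.range K,
        (∏ i, x i ^ a i / ((a i).factorial : ℝ)) • powProd N a := by
  classical
  -- The ordered product is multilinear in its factors, so it distributes over the truncated sums
  -- although the factors need not commute.
  have key : ∀ T : Fin n → Module.End ℝ M, ((List.finRange n).reverse.map T).prod =
      (MultilinearMap.mkPiAlgebraFin ℝ n (Module.End ℝ M)).domDomCongr Fin.revPerm T := by
    intro T
    rw [List.finRange_reverse, List.map_map, MultilinearMap.domDomCongr_apply,
      MultilinearMap.mkPiAlgebraFin_apply, List.ofFn_eq_map]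
    rfl
  rw [expAction_eq_prod, key]
  simp only [truncExp, powProd]
  rw [MultilinearMap.map_sum_finset]
  refine Finset.sum_congr rfl fun a _ => ?_
  rw [MultilinearMap.map_smul_univ, ← key]

end PowProd

/-! ### Extremal polynomials as matrix coefficients. -/

section ExtremalPolynomial

variable {n : ℕ} {J : Set ℤ} {𝔭 : Type*} [LieRing 𝔭] [LieAlgebra ℝ 𝔭]
  {E : Type*} [AddCommGroup E] [Module ℝ E] {ι : E →ₗ[ℝ] 𝔭} {S : Submodule ℝ 𝔭}
  {hS : ∀ u, ∀ y ∈ S, ⁅ι u, y⁆ ∈ S} {X : Fin n → E}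

lemma iterate_lie_right_eq (u : E) (k : ℕ) (Y : S) :
    (fun Z => ⁅Z, ι u⁆)^[k] (Y : 𝔭) =
      (((-1 : ℝ) ^ k • (adRestrict ι S hS u ^ k) Y : S) : 𝔭) := by
  induction k with
  | zero => simp
  | succ k ih =>
    rw [Function.iterate_succ_apply', ih, pow_succ' (adRestrict ι S hS u), Module.End.mul_apply,
      ← lie_skew, pow_succ]
    simp [coe_adRestrict_apply]

/-- Each right bracket is minus a left bracket, whence the sign. The fold acts with the head of the
list first, so the head becomes the rightmost factor, whence the reversal. -/
lemma foldl_iterate_lie_right_eq (α : Fin n → ℕ) (l : List (Fin n)) (Y : S) :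
    l.foldl (fun A i => (fun Z => ⁅Z, ι (X i)⁆)^[α i] A) (Y : 𝔭) =
      (((-1 : ℝ) ^ (l.map α).sum •
        (l.reverse.map fun i => adRestrict ι S hS (X i) ^ α i).prod Y : S) : 𝔭) := by
  induction l generalizing Y with
  | nil => simp
  | cons i l ih =>
    rw [List.foldl_cons, iterate_lie_right_eq (hS := hS), ih, List.reverse_cons, List.map_append,
      List.prod_append, List.map_cons, List.sum_cons, map_smul, smul_smul, ← pow_add, add_comm]
    simp

/-- The linear functional that takes the value `v_k` at `X_k`. -/
noncomputable def valueFunctional (b : Module.Basis J ℝ 𝔭) (v : EuclideanSpace ℝ (Fin n)) :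
    𝔭 →ₗ[ℝ] ℝ := b.constr ℝ fun k : J => extendZero v k

lemma valueFunctional_apply (b : Module.Basis J ℝ 𝔭) (v : EuclideanSpace ℝ (Fin n)) (y : 𝔭) :
    valueFunctional b v y = (b.repr y).sum fun k c => c * extendZero v k :=
  b.constr_apply ℝ _ y

lemma valueFunctional_basis (b : Module.Basis J ℝ 𝔭) (v : EuclideanSpace ℝ (Fin n)) (j : J) :
    valueFunctional b v (b j) = extendZero v j :=
  b.constr_basis ℝ _ j

variable {hJ : Set.Icc 1 (n : ℤ) ⊆ J} {b : Module.Basis J ℝ 𝔭}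

/-- The sign in the definition of `extremalCoeff` cancels the one in `foldl_iterate_lie_right_eq`.
-/
lemma extremalCoeff_eq (hX : ∀ i, ι (X i) = b (posIndex hJ i)) (v : EuclideanSpace ℝ (Fin n))
    {j : J} (hj : b j ∈ S) (α : Fin n →₀ ℕ) :
    extremalCoeff hJ b v j α = (∏ i, ((α i).factorial : ℝ))⁻¹ *
      valueFunctional b v (powProd (fun i => adRestrict ι S hS (X i)) α ⟨b j, hj⟩) := by
  have h1 := foldl_iterate_lie_right_eq (hS := hS) (X := X) α (List.finRange n) ⟨b j, hj⟩
  have h2 : ((List.finRange n).map α).sum = ∑ i, α i := by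
    rw [← List.ofFn_eq_map, List.sum_ofFn]
  simp only [hX] at h1
  rw [extremalCoeff, genStructureConst, ← valueFunctional_apply, iteratedLie, h1, h2,
    Submodule.coe_smul, map_smul, smul_eq_mul, powProd, div_mul_eq_mul_div, ← mul_assoc,
    ← mul_pow]
  simp [div_eq_inv_mul]

/-- The extremal polynomial, as an element of the polynomial ring. -/
noncomputable def extremalMvPolynomial (hJ : Set.Icc 1 (n : ℤ) ⊆ J) (b : Module.Basis J ℝ 𝔭)
    (v : EuclideanSpace ℝ (Fin n)) (K : ℕ) (j : J) : MvPolynomial (Fin n) ℝ :=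
  ∑ a ∈ Fintype.piFinset fun _ : Fin n => Finset.range K,
    MvPolynomial.monomial (Finsupp.equivFunOnFinite.symm a)
      (extremalCoeff hJ b v j (Finsupp.equivFunOnFinite.symm a))

variable {K : ℕ}

lemma coeff_extremalMvPolynomial (hX : ∀ i, ι (X i) = b (posIndex hJ i))
    (hN : ∀ i, adRestrict ι S hS (X i) ^ K = 0) (v : EuclideanSpace ℝ (Fin n))
    {j : J} (hj : b j ∈ S) (α : Fin n →₀ ℕ) :
    (extremalMvPolynomial hJ b v K j).coeff α = extremalCoeff hJ b v j α := by
  classical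
  rw [extremalMvPolynomial, MvPolynomial.coeff_sum]
  simp only [MvPolynomial.coeff_monomial, Equiv.symm_apply_eq]
  by_cases h : ∀ i, α i < K
  · rw [Finset.sum_eq_single (Finsupp.equivFunOnFinite α)]
    · simp
    · intro a _ ha
      rw [if_neg ha]
    · intro ha
      exact absurd (Fintype.mem_piFinset.2 fun i => Finset.mem_range.2 (h i)) ha
  -- An exponent of at least `K` makes one factor vanish, so no coefficient outside the box is lost.
  · push Not at h
    obtain ⟨i, hi⟩ := h
    rw [extremalCoeff_eq (hS := hS) hX v hj, powProd_eq_zero hN hi]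
    simp only [LinearMap.zero_apply, ZeroMemClass.coe_zero, map_zero, mul_zero]
    refine Finset.sum_eq_zero fun a ha => if_neg ?_
    rintro rfl
    exact absurd (Finset.mem_range.1 (Fintype.mem_piFinset.1 ha i)) (not_lt.2 hi)

lemma extremalPolynomial_eq_eval (hX : ∀ i, ι (X i) = b (posIndex hJ i))
    (hN : ∀ i, adRestrict ι S hS (X i) ^ K = 0) (v : EuclideanSpace ℝ (Fin n))
    {j : J} (hj : b j ∈ S) (x : EuclideanSpace ℝ (Fin n)) :
    extremalPolynomial hJ b v j x =
      MvPolynomial.eval (fun i => x i) (extremalMvPolynomial hJ b v K j) := by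
  rw [MvPolynomial.eval_eq', extremalPolynomial]
  simp only [← coeff_extremalMvPolynomial hX hN v hj]
  -- A `finsum` with infinite support would be `0` by convention; the finite support of the
  -- polynomial rules this out.
  refine finsum_eq_sum_of_support_subset _ fun α hα => ?_
  rw [Finset.mem_coe, MvPolynomial.mem_support_iff]
  exact left_ne_zero_of_mul hα

/-- The extremal polynomials are matrix coefficients of `exp (x_n ad X_n) ⋯ exp (x_1 ad X_1)`. -/
lemma extremalPolynomial_eq_expAction (hX : ∀ i, ι (X i) = b (posIndex hJ i))
    (hN : ∀ i, adRestrict ι S hS (X i) ^ K = 0) (v : EuclideanSpace ℝ (Fin n))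
    {j : J} (hj : b j ∈ S) (x : EuclideanSpace ℝ (Fin n)) :
    extremalPolynomial hJ b v j x = valueFunctional b v
      (expAction (fun i => adRestrict ι S hS (X i)) K (List.finRange n) x ⟨b j, hj⟩) := by
  rw [extremalPolynomial_eq_eval hX hN v hj, extremalMvPolynomial, expAction_finRange, map_sum,
    LinearMap.sum_apply, AddSubmonoidClass.coe_finsetSum, map_sum]
  refine Finset.sum_congr rfl fun a _ => ?_
  rw [MvPolynomial.eval_monomial, extremalCoeff_eq (hS := hS) hX v hj, LinearMap.smul_apply,
    Submodule.coe_smul, map_smul, smul_eq_mul, Finset.prod_div_distrib, Finsupp.prod_fintype]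
  · simp only [Finsupp.equivFunOnFinite_symm_apply_apply, Finsupp.coe_equivFunOnFinite_symm]
    ring
  · simp

lemma extremalPolynomial_zero (hJ : Set.Icc 1 (n : ℤ) ⊆ J) (b : Module.Basis J ℝ 𝔭)
    (v : EuclideanSpace ℝ (Fin n)) (j : J) : extremalPolynomial hJ b v j 0 = extendZero v j := by
  rw [extremalPolynomial, finsum_eq_single _ (0 : Fin n →₀ ℕ)]
  · have : iteratedLie (fun i => b (posIndex hJ i)) 0 (b j) = b j := by
      simp [iteratedLie]
    rw [extremalCoeff, genStructureConst, this, ← valueFunctional_apply, valueFunctional_basis]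
    simp
  · intro α hα
    obtain ⟨i, hi⟩ := DFunLike.ne_iff.1 hα
    rw [Finset.prod_eq_zero (Finset.mem_univ i), mul_zero]
    exact zero_pow hi

lemma contDiff_eval_mvPolynomial (p : MvPolynomial (Fin n) ℝ) :
    ContDiff ℝ ∞ fun x : EuclideanSpace ℝ (Fin n) => MvPolynomial.eval (fun i => x i) p := by
  simp only [MvPolynomial.eval_eq']
  fun_prop

end ExtremalPolynomial

/-! ### Functions annihilated by generators of the Lie algebra. -/

section Constancy

variable {F E : Type*} [NormedAddCommGroup F] [NormedSpace ℝ F] [CompleteSpace F]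
  [NormedAddCommGroup E] [NormedSpace ℝ E]

/-- A function is constant if it is constant along the fields that correspond, under a `1`-form
satisfying the Maurer-Cartan equation, to a set of generators of the Lie algebra. -/
lemma eq_of_fderiv_inverse_eq_zero {br : E → E → E} {L : F → F →L[ℝ] E}
    (hL : Differentiable ℝ L) (hinv : ∀ x, (L x).IsInvertible)
    (hmc : ∀ x u w, fderiv ℝ L x u w - fderiv ℝ L x w u = - br (L x u) (L x w))
    {T : Set E} (hT : ∀ S : Submodule ℝ E, T ⊆ S → (∀ x ∈ S, ∀ y ∈ S, br x y ∈ S) → S = ⊤)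
    {f : F → ℝ} (hf : ContDiff ℝ 2 f) (h : ∀ Y ∈ T, ∀ x, fderiv ℝ f x ((L x).inverse Y) = 0)
    (x y : F) : f x = f y := by
  -- The directions along whose fields `f` is constant; by `fderiv_inverse_bracket_eq_zero` they
  -- form a Lie subalgebra.
  let S : Submodule ℝ E :=
    { carrier := {Y | ∀ x, fderiv ℝ f x ((L x).inverse Y) = 0}
      add_mem' := fun hY hZ x => by rw [map_add, map_add, hY x, hZ x, add_zero]
      zero_mem' := fun x => by rw [map_zero, map_zero]
      smul_mem' := fun c Y hY x => by rw [map_smul, map_smul, hY x, smul_zero] }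
  have hS : S = ⊤ := hT S h fun Y hY Z hZ => fderiv_inverse_bracket_eq_zero hL hinv hmc hf hY hZ
  refine is_const_of_fderiv_eq_zero (𝕜 := ℝ) (hf.differentiable (by simp)) (fun x => ?_) x y
  ext u
  have h1 : L x u ∈ S := hS ▸ Submodule.mem_top
  have h2 : (L x).inverse (L x u) = u := by
    rw [← ContinuousLinearMap.comp_apply, (hinv x).inverse_comp_self]; rfl
  have h3 := h1 x
  rwa [h2] at h3

end Constancy

/-! ### The structure formula. -/

section StructureFormula

variable {n : ℕ} {J : Set ℤ} {𝔭 : Type*} [LieRing 𝔭] [LieAlgebra ℝ 𝔭]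
  {E : Type*} [NormedAddCommGroup E] [NormedSpace ℝ E] {ι : E →ₗ[ℝ] 𝔭}
  {br : E →L[ℝ] E →L[ℝ] E} {X : Fin n → E} {hJ : Set.Icc 1 (n : ℤ) ⊆ J} {b : Module.Basis J ℝ 𝔭}
  {d : J → ℤ} {m : ℤ} {K : ℕ}

/-- `[X_i, X_j]` is only a combination of basis vectors, so the matrix coefficient formula is
extended by linearity to the whole filtration step. -/
lemma sum_repr_extremalPolynomial
    {hS : ∀ u, ∀ y ∈ basisFiltration b d m, ⁅ι u, y⁆ ∈ basisFiltration b d m}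
    (hX : ∀ i, ι (X i) = b (posIndex hJ i))
    (hN : ∀ i, adRestrict ι (basisFiltration b d m) hS (X i) ^ K = 0)
    (v x : EuclideanSpace ℝ (Fin n)) (Y : basisFiltration b d m) :
    ((b.repr Y).sum fun k c => c * extremalPolynomial hJ b v k x) = valueFunctional b v
      (expAction (fun i => adRestrict ι (basisFiltration b d m) hS (X i)) K
        (List.finRange n) x Y) := by
  obtain ⟨y, hy⟩ := Y
  refine (b.constr_apply ℝ (fun k => extremalPolynomial hJ b v k x) y).symm.trans ?_
  induction hy using Submodule.span_induction with
  | zero =>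
    have : (⟨0, zero_mem _⟩ : basisFiltration b d m) = 0 := rfl
    rw [map_zero]
    refine Eq.symm (Eq.trans (congrArg _ (congrArg _ (congrArg _ this))) ?_)
    simp only [map_zero, Submodule.coe_zero]
  | add y z hy hz h1 h2 =>
    have : (⟨y + z, add_mem hy hz⟩ : basisFiltration b d m) = ⟨y, hy⟩ + ⟨z, hz⟩ := rfl
    rw [map_add, h1, h2]
    refine Eq.symm (Eq.trans (congrArg _ (congrArg _ (congrArg _ this))) ?_)
    simp only [map_add, Submodule.coe_add]
  | smul c y hy h1 =>
    have : (⟨c • y, Submodule.smul_mem _ c hy⟩ : basisFiltration b d m) = c • ⟨y, hy⟩ := rfl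
    rw [map_smul, h1]
    refine Eq.symm (Eq.trans (congrArg _ (congrArg _ (congrArg _ this))) ?_)
    simp only [map_smul, Submodule.coe_smul]
  | mem y hy =>
    obtain ⟨j, hj, rfl⟩ := hy
    rw [b.constr_basis]
    exact extremalPolynomial_eq_expAction hX hN v (basis_mem_basisFiltration j hj) x

/-- The structure formula for the extremal polynomials. -/
lemma fderiv_extremalPolynomial [FiniteDimensional ℝ E]
    (hι : ∀ u w, ι (br u w) = ⁅ι u, ι w⁆) (hK : ∀ i, br (X i) ^ K = 0)
    {hS : ∀ u, ∀ y ∈ basisFiltration b d m, ⁅ι u, y⁆ ∈ basisFiltration b d m}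
    (hX : ∀ i, ι (X i) = b (posIndex hJ i))
    (hN : ∀ i, adRestrict ι (basisFiltration b d m) hS (X i) ^ K = 0)
    (v : EuclideanSpace ℝ (Fin n)) {x : EuclideanSpace ℝ (Fin n)}
    (hinv : (mcForm br X K (List.finRange n) x).IsInvertible)
    (i : Fin n) {j : J} (hj : m ≤ d j) :
    fderiv ℝ (extremalPolynomial hJ b v j) x
        ((mcForm br X K (List.finRange n) x).inverse (X i)) =
      (structureConst b (posIndex hJ i) j).sum fun k c => c * extremalPolynomial hJ b v k x := by
  have h1 := hasFDerivAt_expAction (br := br) (fun u w => adRestrict_bracket hS (hι u w)) hK hN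
    (List.finRange n) (valueFunctional b v ∘ₗ (basisFiltration b d m).subtype) x
    ⟨b j, basis_mem_basisFiltration j hj⟩
  have h2 : extremalPolynomial hJ b v j = fun x => (valueFunctional b v ∘ₗ
      (basisFiltration b d m).subtype) (expAction (fun i => adRestrict ι _ hS (X i)) K
        (List.finRange n) x ⟨b j, basis_mem_basisFiltration j hj⟩) :=
    funext fun x => extremalPolynomial_eq_expAction hX hN v (basis_mem_basisFiltration j hj) x
  have h3 : mcForm br X K (List.finRange n) x
      ((mcForm br X K (List.finRange n) x).inverse (X i)) = X i := by
    rw [← ContinuousLinearMap.comp_apply, hinv.self_comp_inverse]; rfl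
  have h4 := sum_repr_extremalPolynomial hX hN v x
    (adRestrict ι _ hS (X i) ⟨b j, basis_mem_basisFiltration j hj⟩)
  rw [coe_adRestrict_apply, hX] at h4
  -- The derivative in direction `u` is `λ(A(x) [ω_x(u), X_j])`; here `ω_x(u) = X_i`.
  rw [structureConst, h4, h2, h1.fderiv]
  simp [h3]

end StructureFormula

/-! ### Assembly of the theorem. -/

theorem theorem2p1 {n : ℕ}
    -- a simply connected Lie group of dimension `n`, with a stratified Lie algebra
    {G : Type*} [TopologicalSpace G] [T2Space G] [SimplyConnectedSpace G]
    [ChartedSpace (EuclideanSpace ℝ (Fin n)) G] [Group G] [LieGroup (𝓡 n) ∞ G]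
    (V : ℕ → Submodule ℝ (GroupLieAlgebra (𝓡 n) G)) (hV : IsStratification V)
    -- the Tanaka prolongation of its Lie algebra
    {𝔭 : Type*} [LieRing 𝔭] [LieAlgebra ℝ 𝔭] (W : ℤ → Submodule ℝ 𝔭)
    (ι : GroupLieAlgebra (𝓡 n) G →ₗ⁅ℝ⁆ 𝔭) (hP : IsTanakaProlongation V W ι)
    -- the index set: either `{j ∈ ℤ | j ≤ n}` or `{m, m + 1, …, n}`
    (J : Set ℤ) (hJ : Set.Icc 1 (n : ℤ) ⊆ J) (hJn : J ⊆ Set.Iic (n : ℤ)) (hJc : J.OrdConnected)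
    -- a basis `X_j`, `j ∈ J`, adapted to the grading, that extends the basis `X₁, …, Xₙ`
    (X : Module.Basis (Fin n) ℝ (GroupLieAlgebra (𝓡 n) G))
    (b : Module.Basis J ℝ 𝔭) (hXb : ∀ i : Fin n, ι (X i) = b (posIndex hJ i))
    (d : J → ℤ) (hd : Monotone d) (hbd : ∀ j : J, b j ∈ W (d j))
    (v : EuclideanSpace ℝ (Fin n)) :
    -- exponential coordinates of the second type are nondegenerate at every point
    (∀ x : EuclideanSpace ℝ (Fin n),
      (mfderiv (𝓡 n) (𝓡 n) (secondKindExp (G := G) X) x).IsInvertible) ∧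
    -- the extremal polynomials are polynomials, with the coefficients in their definition
    (∀ j : J, ∃ p : MvPolynomial (Fin n) ℝ,
      (∀ α : Fin n →₀ ℕ, p.coeff α = extremalCoeff hJ b v j α) ∧
      ∀ x : EuclideanSpace ℝ (Fin n), extremalPolynomial hJ b v j x =
        MvPolynomial.eval (fun i => x i) p) ∧
    -- the structure formulas
    (∀ (i : Fin n) (j : J) (x : EuclideanSpace ℝ (Fin n)),
      fderiv ℝ (extremalPolynomial hJ b v j) x (coordField X (X i) x) =
        (structureConst b (posIndex hJ i) j).sum
          fun k c => c * extremalPolynomial hJ b v k x) ∧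
    -- the initial values
    (∀ j : J, extremalPolynomial hJ b v j 0 = extendZero v j) ∧
    -- uniqueness, from the formulas for `i = 1, …, r` and the initial values
    (∀ Q : J → EuclideanSpace ℝ (Fin n) → ℝ, (∀ j : J, ContDiff ℝ ∞ (Q j)) →
      (∀ i : Fin n, (i : ℕ) < Module.finrank ℝ (V 1) →
        ∀ (j : J) (x : EuclideanSpace ℝ (Fin n)),
          fderiv ℝ (Q j) x (coordField X (X i) x) =
            (structureConst b (posIndex hJ i) j).sum fun k c => c * Q k x) →
      (∀ j : J, Q j 0 = extendZero v j) →
      ∀ j : J, Q j = extremalPolynomial hJ b v j) := by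
  obtain ⟨s, hs⟩ := hP.exists_degree_le hV hbd
  -- `X'` and `ι'` are `X` and `ι` seen on the model space, to which `GroupLieAlgebra` unfolds.
  let X' : Module.Basis (Fin n) ℝ (EuclideanSpace ℝ (Fin n)) := X
  let ι' : EuclideanSpace ℝ (Fin n) →ₗ[ℝ] 𝔭 := (ι : GroupLieAlgebra (𝓡 n) G →ₗ[ℝ] 𝔭)
  have hXb' : ∀ i, ι' (X' i) = b (posIndex hJ i) := hXb
  have hι : ∀ u w, ι' (groupBracketCLM n G u w) = ⁅ι' u, ι' w⁆ := fun u w =>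
    LieHom.map_lie ι (u : GroupLieAlgebra (𝓡 n) G) w
  have hinj : Function.Injective ι' := hP.injective
  have hF : ∀ u k, ∀ y ∈ basisFiltration b d k, ⁅ι' u, y⁆ ∈ basisFiltration b d (k + 1) :=
    fun u _ _ hy => hP.lie_mem_basisFiltration_add_one hV hbd u hy
  have hF' : ∀ m u, ∀ y ∈ basisFiltration b d m, ⁅ι' u, y⁆ ∈ basisFiltration b d m :=
    fun m u y hy => basisFiltration_antitone (by omega) (hF u m y hy)
  have hone : ∀ u, ι' u ∈ basisFiltration b d 1 :=
    (hP.map_mem_basisFiltration_one hV hbd : ∀ u, ι u ∈ basisFiltration b d 1)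
  have hanti : Antitone (basisFiltration b d) := fun _ _ h => basisFiltration_antitone h
  -- The image of `𝔤` lies in degrees at least `1`, so `s < 1 + K` suffices on `𝔤`; on the
  -- filtration step `m` the condition becomes `s < m + K`.
  have hK : ∀ K : ℕ, s < 1 + K → ∀ i, groupBracketCLM n G (X' i) ^ K = 0 := fun K h i =>
    bracket_pow_eq_zero hι hinj hF hone (basisFiltration_eq_bot hs h) (X' i)
  have hinv : ∀ K : ℕ, s < 1 + K → 1 ≤ K → ∀ x,
      (mcForm (groupBracketCLM n G) X' K (List.finRange n) x).IsInvertible := fun K h h1 x =>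
    mcForm_isInvertible X' hι hanti hF h1 (basisFiltration_eq_bot hs h)
      (fun u k hu i hi => by
        rw [hXb']
        refine basis_mem_basisFiltration _ (mem_basisFiltration_iff.1 hu _ ?_)
        exact (repr_map_posIndex hXb u i).trans_ne hi)
      hinj hone x
  have hN : ∀ (m : ℤ) (K : ℕ), s < m + K → ∀ i, adRestrict ι' _ (hF' m) (X' i) ^ K = 0 :=
    fun m K h i => adRestrict_pow_eq_zero hF (hF' m) (basisFiltration_eq_bot hs h) (X' i)
  have hpoly : ∀ j : J, ∃ p : MvPolynomial (Fin n) ℝ,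
      (∀ α : Fin n →₀ ℕ, p.coeff α = extremalCoeff hJ b v j α) ∧
      ∀ x : EuclideanSpace ℝ (Fin n), extremalPolynomial hJ b v j x =
        MvPolynomial.eval (fun i => x i) p := by
    intro j
    have h := hN (d j) (s + 1 - d j).toNat (by omega)
    have hj := basis_mem_basisFiltration (b := b) (d := d) j le_rfl
    exact ⟨_, coeff_extremalMvPolynomial hXb' h v hj, extremalPolynomial_eq_eval hXb' h v hj⟩
  have hstruct : ∀ (i : Fin n) (j : J) (x : EuclideanSpace ℝ (Fin n)),
      fderiv ℝ (extremalPolynomial hJ b v j) x (coordField X (X i) x) =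
        (structureConst b (posIndex hJ i) j).sum
          fun k c => c * extremalPolynomial hJ b v k x := by
    intro i j x
    -- One `K` must serve both the form on `𝔤` and the action on the filtration step `d j`.
    obtain ⟨K, hK1, hK2, hK3⟩ : ∃ K : ℕ, s < 1 + K ∧ s < d j + K ∧ 1 ≤ K :=
      ⟨(s + 1 - d j).toNat + s.toNat + 1, by omega, by omega, by omega⟩
    refine Eq.trans ?_ (fderiv_extremalPolynomial hι (hK K hK1) hXb' (hN (d j) K hK2) v
      (hinv K hK1 hK3 x) i le_rfl)
    exact congrArg _ (coordField_eq_inverse (hK K hK1) (hinv K hK1 hK3) (X' i) x)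
  have hzero := extremalPolynomial_zero hJ b v
  obtain ⟨K, hK1, hK2⟩ : ∃ K : ℕ, s < 1 + K ∧ 1 ≤ K := ⟨s.toNat + 1, by omega, by omega⟩
  refine ⟨mfderiv_secondKindExp_isInvertible (hK K hK1) (hinv K hK1 hK2), hpoly, hstruct, hzero,
    fun Q hQ hQX hQ0 => ?_⟩
  -- Descending induction on the degree: no `d j` exceeds `s`, and the bracket `[X_i, X_j]` involves
  -- only degrees above `d j`, where `Q` is already known.
  have key : ∀ (N : ℕ) (j : J), s < d j + N → Q j = extremalPolynomial hJ b v j := by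
    intro N
    induction N with
    | zero => exact fun j hj => absurd (hs j) (by push_cast at hj; omega)
    | succ N ih =>
      intro j hj
      have hcoef : ∀ (i : Fin n) (k : J), k ∈ (structureConst b (posIndex hJ i) j).support →
          Q k = extremalPolynomial hJ b v k := by
        intro i k hk
        have h1 := hF (X' i) (d j) _ (basis_mem_basisFiltration j le_rfl)
        rw [hXb'] at h1
        have h2 := mem_basisFiltration_iff.1 h1 k (Finsupp.mem_support_iff.1 hk)
        exact ih k (by push_cast at hj; omega)
      have hP' : ContDiff ℝ ∞ (extremalPolynomial hJ b v j) := by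
        obtain ⟨p, -, hp⟩ := hpoly j
        rw [funext hp]
        exact contDiff_eval_mvPolynomial p
      have hzero' : ∀ Y ∈ X' '' {i | (i : ℕ) < Module.finrank ℝ (V 1)}, ∀ x,
          fderiv ℝ (fun y => Q j y - extremalPolynomial hJ b v j y) x
            ((mcForm (groupBracketCLM n G) X' K (List.finRange n) x).inverse Y) = 0 := by
        rintro _ ⟨i, hi, rfl⟩ x
        have h1 := coordField_eq_inverse (hK K hK1) (hinv K hK1 hK2) (X' i) x
        rw [← h1, fderiv_fun_sub ((hQ j).differentiable (by simp) x)
          (hP'.differentiable (by simp) x)]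
        refine (congrArg₂ (· - ·) (hQX i hi j x) (hstruct i j x)).trans ?_
        rw [sub_eq_zero]
        exact Finsupp.sum_congr fun k hk => by rw [hcoef i k hk]
      -- The generating set consists of `X_1, …, X_r`, whose span contains the first layer, which
      -- generates the Lie algebra.
      have hconst := eq_of_fderiv_inverse_eq_zero (br := fun u w => groupBracketCLM n G u w)
        (differentiable_mcForm (hK K hK1) _) (hinv K hK1 hK2)
        (fderiv_mcForm_sub groupBracketCLM_self groupBracketCLM_jacobi (hK K hK1) _)
        (fun S hS hSbr => hV.eq_top_of_forall_lie_mem (S := S)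
          ((hP.first_layer_le_span hV hXb hd hbd).trans (Submodule.span_le.2 hS)) hSbr)
        (((hQ j).sub hP').of_le two_le_infty) hzero'
      funext x
      have h1 := hconst x 0
      rw [hQ0, hzero, sub_self] at h1
      exact sub_eq_zero.1 h1
  exact fun j => key (s + 1 - d j).toNat j (by omega)
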